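/- A permutation $\sigma$ of length $n \ge 0$ is a bijection of $\{1,\dots,n\}$ onto itself, written as the word $\sigma_1\sigma_2\cdots\sigma_n$. A permutation $\pi$ of length $k$ is a pattern of $\sigma$ if there are indices $1\le i_1<\dots<i_k\le n$ such that $\sigma_{i_\ell}<\sigma_{i_m}$ whenever $\pi_\ell<\pi_m$. A permutation is separable if neither $2413$ nor $3142$ is a pattern of it. Theorem. For every fixed integer $K\ge 1$, the problem of computing a longest common separable pattern of $K$ permutations is solvable in polynomial time: there is a deterministic (multi-stack) Turing machine which, given any $K$ permutations $\sigma^1,\dots,\sigma^K$ (of arbitrary lengths, each written as the word of its values in binary), outputs, in a number of steps polynomial in the length of the input, a separable permutation $\pi$ that is a pattern of every $\sigma^q$, $1\le q\le K$, and has maximal length among all separable permutations that are patterns of every $\sigma^q$. -/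

import Mathlib

namespace LCSep

open Computability

/-- A permutation `σ` of some finite length `n`. Indices and values are `0, …, n - 1`
instead of `1, …, n`. The length `0` is allowed: it is the empty permutation. -/
abbrev FinPerm : Type := Σ n : ℕ, Equiv.Perm (Fin n)

/-- The length of a permutation. -/
abbrev FinPerm.length (σ : FinPerm) : ℕ := σ.1

/-- `π` is a pattern of `σ`: there are indices `i_1 < ⋯ < i_k` such that
`σ_{i_l} < σ_{i_m}` whenever `π_l < π_m`. -/
def IsPattern (π σ : FinPerm) : Prop :=
  ∃ i : Fin π.length → Fin σ.length, StrictMono i ∧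
    ∀ l m, π.2 l < π.2 m → σ.2 (i l) < σ.2 (i m)

/-- The permutation `2 4 1 3`. -/
def perm2413 : FinPerm := ⟨4, ⟨![1, 3, 0, 2], ![2, 0, 3, 1], by decide, by decide⟩⟩

/-- The permutation `3 1 4 2`. -/
def perm3142 : FinPerm := ⟨4, ⟨![2, 0, 3, 1], ![1, 3, 0, 2], by decide, by decide⟩⟩

/-- A permutation is separable if it avoids the patterns `2413` and `3142`. -/
def IsSeparable (σ : FinPerm) : Prop := ¬ IsPattern perm2413 σ ∧ ¬ IsPattern perm3142 σ

/-- `π` is a common separable pattern of `σ_1, …, σ_K`. -/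
def IsCommonSeparablePattern {K : ℕ} (σ : Fin K → FinPerm) (π : FinPerm) : Prop :=
  IsSeparable π ∧ ∀ q, IsPattern π (σ q)

/-- `π` is a longest common separable pattern of `σ_1, …, σ_K`. -/
def IsLongestCommonSeparablePattern {K : ℕ} (σ : Fin K → FinPerm) (π : FinPerm) : Prop :=
  IsCommonSeparablePattern σ π ∧
    ∀ τ : FinPerm, IsCommonSeparablePattern σ τ → τ.length ≤ π.length

/-- A natural number in binary (least significant bit first), followed by a comma. -/
def encodeEntry (v : ℕ) : List Γ' := (encodeNat v).map Γ'.bit ++ [Γ'.comma]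

/-- A permutation `σ` as the word `σ_1 σ_2 … σ_n` on the values `1, …, n`, each one written in
binary and followed by a comma; a closing bracket ends the word. -/
def encodePerm (σ : FinPerm) : List Γ' :=
  (List.ofFn fun i => (σ.2 i : ℕ) + 1).flatMap encodeEntry ++ [Γ'.ket]

/-- A tuple of permutations as the concatenation of the words of its members. -/
def encodeTuple {K : ℕ} (σ : Fin K → FinPerm) : List Γ' :=
  (List.ofFn σ).flatMap encodePerm

/-- The search problem "given `a`, compute some `b` with `R a b`", with inputs and outputs written
as words over finite alphabets by `ea` and `eb`, is solvable in polynomial time: some function `f`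
that picks a correct output for every input is computed by a Turing machine that runs in time
polynomial in the length of the input word. -/
def SolvableInPolyTime {α β A B : Type} [Fintype A] [Fintype B]
    (ea : α → List A) (eb : β → List B) (R : α → β → Prop) : Prop :=
  ∃ f : α → β, (∀ a, R a (f a)) ∧ Nonempty (Turing.TM2ComputableInPolyTime ea eb f)

/-! The encodings are faithful: distinct objects have distinct words. -/

theorem append_cons_cancel {A : Type} {c : A} : ∀ {l l' s t : List A}, c ∉ l → c ∉ l' →
    l ++ c :: s = l' ++ c :: t → l = l' ∧ s = t
  | [], [], _, _, _, _, h => by simpa using h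
  | [], _ :: _, _, _, _, h', h => by simp_all
  | _ :: _, [], _, _, h', _, h => by simp_all
  | a :: l, b :: l', s, t, h₁, h₂, h => by
    simp only [List.mem_cons, not_or] at h₁ h₂
    simp only [List.cons_append, List.cons.injEq] at h ⊢
    have := append_cons_cancel h₁.2 h₂.2 h.2
    exact ⟨⟨h.1, this.1⟩, this.2⟩

theorem encodeEntry_append {v w : ℕ} {s t : List Γ'}
    (h : encodeEntry v ++ s = encodeEntry w ++ t) : v = w ∧ s = t := by
  simp only [encodeEntry, List.append_assoc, List.singleton_append] at h
  obtain ⟨h₁, h₂⟩ := append_cons_cancel (by simp) (by simp) h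
  refine ⟨?_, h₂⟩
  have h₃ := List.map_injective_iff.mpr inclusionBoolΓ'_injective h₁
  exact encodingNatBool.encode_injective h₃

theorem encodeEntry_ne_ket (v : ℕ) (s t : List Γ') : encodeEntry v ++ s ≠ Γ'.ket :: t := by
  intro h
  unfold encodeEntry at h
  cases hv : encodeNat v <;> simp [hv] at h

theorem flatMap_encodeEntry_append : ∀ {l l' : List ℕ} {s t : List Γ'},
    l.flatMap encodeEntry ++ Γ'.ket :: s = l'.flatMap encodeEntry ++ Γ'.ket :: t →
      l = l' ∧ s = t
  | [], [], _, _, h => by simpa using h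
  | [], w :: l', _, _, h => by
    simp only [List.flatMap_cons, List.append_assoc] at h
    exact absurd h.symm (encodeEntry_ne_ket _ _ _)
  | v :: l, [], _, _, h => by
    simp only [List.flatMap_cons, List.append_assoc] at h
    exact absurd h (encodeEntry_ne_ket _ _ _)
  | v :: l, w :: l', s, t, h => by
    simp only [List.flatMap_cons, List.append_assoc] at h
    obtain ⟨rfl, h'⟩ := encodeEntry_append h
    obtain ⟨rfl, h''⟩ := flatMap_encodeEntry_append h'
    exact ⟨rfl, h''⟩

theorem encodePerm_append {σ τ : FinPerm} {s t : List Γ'}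
    (h : encodePerm σ ++ s = encodePerm τ ++ t) : σ = τ ∧ s = t := by
  simp only [encodePerm, List.append_assoc, List.singleton_append] at h
  obtain ⟨h₁, h₂⟩ := flatMap_encodeEntry_append h
  refine ⟨?_, h₂⟩
  obtain ⟨n, σ⟩ := σ
  obtain ⟨m, τ⟩ := τ
  obtain rfl : n = m := by simpa using congrArg List.length h₁
  congr 1
  ext i
  have := congrFun (List.ofFn_injective h₁) i
  simpa using this

theorem encodePerm_injective : Function.Injective encodePerm := fun σ τ h =>
  (encodePerm_append (s := []) (t := []) (by simpa using h)).1

theorem encodeTuple_injective {K : ℕ} :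
    Function.Injective (encodeTuple : (Fin K → FinPerm) → List Γ') := by
  suffices H : ∀ l l' : List FinPerm, l.length = l'.length →
      l.flatMap encodePerm = l'.flatMap encodePerm → l = l' from
    fun σ τ h => List.ofFn_injective (H _ _ (by simp) h)
  intro l
  induction l with
  | nil => intro l' h _; exact (List.length_eq_zero_iff.mp h.symm).symm
  | cons a l ih =>
    rintro (_ | ⟨b, l'⟩) hl h
    · simp at hl
    · simp only [List.flatMap_cons] at h
      obtain ⟨rfl, h'⟩ := encodePerm_append h
      rw [ih l' (by simpa using hl) h']

end LCSep

namespace LCSep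
open Computability Turing

/-! ### A structured language on stacks and its translation to multi-stack machines -/

/-! A sequence that avoids 2413 and 3142 and has at least two terms can be cut into an initial and a
final part such that all values of one part lie below all values of the other (`exists_cut`). Hence
the separable permutations are exactly those built from single points by direct and skew sums
(`SepWord.sum` gives the converse).

An occurrence of a common pattern in the `K` given words is summarised by its bounding boxes: least
and greatest position and value in each word, `4 * K` numbers in all. Whether two occurrences can be
joined to an occurrence of a direct or skew sum, and the boxes and length of the result, depend only
on the boxes and lengths of the two (`Occurs.sum`). It therefore suffices to keep one word for each
choice of boxes and length. Starting from single points, a table is closed repeatedly under all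
admissible sums. Its entries always describe genuine common separable patterns (`GoodTable.round`),
and after `r` rounds every part of length at most `r + 1` of a common separable pattern is
represented with its exact boxes (`CommonOcc.exists_mem`). With enough rounds, a longest word of the
table is a solution (`solution_spec`). Distinct entries differ in a list of `4 * K + 1` numbers of
size at most `N`, so the table has at most `(N + 1) ^ (4 * K + 1)` entries, a polynomial in `N` for
fixed `K` (`GoodTable.esize_le`).

To obtain a Turing machine, structured programs on six stacks are compiled to multi-stack machines
(`stepsTo_compile`). Data are binary trees in prefix notation, and `PT` is the class of functions
computed by such programs in polynomial time. It is closed under composition, pairing, case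
distinction and folds with polynomially bounded accumulators (`PT.foldl`), and the whole algorithm
is expressed by these means (`PT.solution`). Numbers may be unary inside the machine, because all of
them are bounded by the input length. -/

/-- The stacks of the machine: three stacks for data, two for temporary use, and one for the input
and the output. -/
inductive Stk
  | main | aux | alt | rev | cnt | io
  deriving DecidableEq

/-- The contents of all stacks. -/
abbrev Store : Type := Stk → List Γ'

instance : Fintype Stk :=
  ⟨{.main, .aux, .alt, .rev, .cnt, .io}, fun k => by cases k <;> decide⟩

/-- Structured programs. The tests look at the top symbol of a stack; `move i js` pops a symbol
from `i` and pushes it onto every stack in `js`. -/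
inductive Prog
  | push (k : Stk) (c : Γ')
  | pop (k : Stk)
  | move (i : Stk) (js : List Stk)
  | seq (p q : Prog)
  | ite (k : Stk) (f : Option Γ' → Bool) (p q : Prog)
  | loop (k : Stk) (f : Option Γ' → Bool) (p : Prog)

infixr:60 ";;" => Prog.seq

/-- Push `c` onto every stack in `js`. -/
def pushAll (c : Γ') (js : List Stk) (s : Store) : Store :=
  fun k => if k ∈ js then c :: s k else s k

/-- `Exec p s t s'`: started on `s`, the program `p` halts after `t` steps on `s'`. -/
inductive Exec : Prog → Store → ℕ → Store → Prop
  | push (k c s) : Exec (.push k c) s 1 (Function.update s k (c :: s k))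
  | pop (k s) : Exec (.pop k) s 1 (Function.update s k (s k).tail)
  -- `pushAll` tests membership only, whereas the compiled code pushes once per list entry; they
  -- agree when there are no repetitions. The symbol is popped before the pushes, so `i` itself may
  -- belong to `js`.
  | move {i js s c r} : js.Nodup → s i = c :: r →
      Exec (.move i js) s 1 (pushAll c js (Function.update s i r))
  | seq {p q s t s' t' s''} : Exec p s t s' → Exec q s' t' s'' → Exec (p ;; q) s (t + t') s''
  | iteTrue {k f p q s t s'} : f (s k).head? = true → Exec p s t s' →
      Exec (.ite k f p q) s (t + 1) s'
  | iteFalse {k f p q s t s'} : f (s k).head? = false → Exec q s t s' →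
      Exec (.ite k f p q) s (t + 1) s'
  | loopTrue {k f p s t s' t' s''} : f (s k).head? = true → Exec p s t s' →
      Exec (.loop k f p) s' t' s'' → Exec (.loop k f p) s (t + t' + 1) s''
  | loopFalse {k f p s} : f (s k).head? = false → Exec (.loop k f p) s 1 s

/-- The labels used in the translation of a program. -/
def Lab : Prog → Type
  | .push _ _ | .pop _ | .move _ _ => Unit
  | .seq p q => Lab p ⊕ Lab q
  | .ite _ _ p q => Option (Lab p ⊕ Lab q)
  | .loop _ _ p => Option (Lab p)

instance Lab.fintype : ∀ p, Fintype (Lab p)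
  | .push _ _ | .pop _ | .move _ _ => inferInstanceAs (Fintype Unit)
  | .seq p q => @instFintypeSum _ _ (Lab.fintype p) (Lab.fintype q)
  | .ite _ _ p q => @instFintypeOption _ (@instFintypeSum _ _ (Lab.fintype p) (Lab.fintype q))
  | .loop _ _ p => @instFintypeOption _ (Lab.fintype p)

/-- The label at which a program starts. -/
def entry : ∀ p, Lab p
  | .push _ _ | .pop _ | .move _ _ => ()
  | .seq p _ => Sum.inl (entry p)
  | .ite _ _ _ _ | .loop _ _ _ => none

/-- Statements of the machine; the internal state holds the symbol read last. -/
abbrev MStmt (L : Type) : Type := TM2.Stmt (σ := Option Γ') (Γ := fun _ : Stk => Γ') (Λ := L)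

/-- Configurations of the machine. -/
abbrev MCfg (L : Type) : Type := TM2.Cfg (σ := Option Γ') (Γ := fun _ : Stk => Γ') (Λ := L)

/-- Push the symbol read last onto every stack in the list and go on with `q`. -/
def pushes {L : Type} (js : List Stk) (q : MStmt L) : MStmt L :=
  js.foldr (fun j q => .push j (fun v => v.getD .blank) q) q

/-- The code of a program, with labels embedded by `emb`, which goes to `exit` at its end. -/
def compile {L : Type} : ∀ p : Prog, (Lab p → L) → L → Lab p → MStmt L
  | .push k c, _, exit => fun _ => .push k (fun _ => c) (.goto fun _ => exit)
  | .pop k, _, exit => fun _ => .pop k (fun v _ => v) (.goto fun _ => exit)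
  | .move i js, _, exit => fun _ => .pop i (fun _ o => o) (pushes js (.goto fun _ => exit))
  | .seq p q, emb, exit => fun l => Sum.casesOn l
      (compile p (fun l => emb (Sum.inl l)) (emb (Sum.inr (entry q))))
      (compile q (fun l => emb (Sum.inr l)) exit)
  | .ite k f p q, emb, exit => fun l => Option.casesOn l
      (.peek k (fun _ o => o) (.branch f (.goto fun _ => emb (some (Sum.inl (entry p))))
        (.goto fun _ => emb (some (Sum.inr (entry q))))))
      (fun l => Sum.casesOn l (compile p (fun l => emb (some (Sum.inl l))) exit)
        (compile q (fun l => emb (some (Sum.inr l))) exit))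
  | .loop k f p, emb, exit => fun l => Option.casesOn l
      (.peek k (fun _ o => o) (.branch f (.goto fun _ => emb (some (entry p)))
        (.goto fun _ => exit)))
      (compile p (fun l => emb (some l)) (emb none))

/-- The machine with code `M` goes in `t` steps from `a` to `b`. -/
def StepsTo {L : Type} (M : L → MStmt L) (a : MCfg L) (t : ℕ) (b : MCfg L) : Prop :=
  (flip bind (TM2.step M))^[t] (some a) = some b

theorem StepsTo.one {L : Type} {M : L → MStmt L} {l : L} {v : Option Γ'} {s : Store} {b : MCfg L}
    (h : TM2.stepAux (M l) v s = b) : StepsTo M ⟨some l, v, s⟩ 1 b := by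
  subst h; rfl

theorem StepsTo.trans {L : Type} {M : L → MStmt L} {a b c : MCfg L} {t t' : ℕ}
    (h : StepsTo M a t b) (h' : StepsTo M b t' c) : StepsTo M a (t + t') c := by
  unfold StepsTo at *
  rw [add_comm, Function.iterate_add_apply, h, h']

theorem stepAux_pushes {L : Type} (c : Γ') (q : MStmt L) :
    ∀ (js : List Stk) (s : Store), js.Nodup →
      TM2.stepAux (pushes js q) (some c) s = TM2.stepAux q (some c) (pushAll c js s)
  | [], s, _ => by
    have : pushAll c [] s = s := by funext k; simp [pushAll]
    rw [this]
    rfl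
  | j :: js, s, h => by
    simp only [List.nodup_cons] at h
    have ih := stepAux_pushes c q js (Function.update s j (c :: s j)) h.2
    have : pushAll c js (Function.update s j (c :: s j)) = pushAll c (j :: js) s := by
      funext k
      by_cases hk : k = j
      · subst hk; simp [pushAll, h.1]
      · simp [pushAll, hk]
    rw [← this, ← ih]
    rfl

/-- Induction on the execution. Subprograms run inside the same machine `M`, so `emb` and `exit`
must be arbitrary for the induction to pass. The internal state is not tracked, since every test and
move reads its symbol afresh. -/
theorem stepsTo_compile {p : Prog} {s : Store} {t : ℕ} {s' : Store} (h : Exec p s t s') :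
    ∀ {L : Type} (M : L → MStmt L) (emb : Lab p → L) (exit : L),
      (∀ l, M (emb l) = compile p emb exit l) →
      ∀ v, ∃ v', StepsTo M ⟨some (emb (entry p)), v, s⟩ t ⟨some exit, v', s'⟩ := by
  induction h with
  | push k c s => exact fun M emb exit hM v => ⟨v, .one (by rw [hM]; rfl)⟩
  | pop k s => exact fun M emb exit hM v => ⟨v, .one (by rw [hM]; rfl)⟩
  | @move i js s c r hjs hs =>
    refine fun M emb exit hM v => ⟨some c, .one ?_⟩
    rw [hM]
    simp only [compile, TM2.stepAux, hs, List.head?_cons, List.tail_cons]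
    rw [stepAux_pushes _ _ _ _ hjs]
    rfl
  | seq _ _ ih₁ ih₂ =>
    intro L M emb exit hM v
    obtain ⟨v₁, h₁⟩ := ih₁ M (fun l => emb (Sum.inl l)) _ (fun l => hM (Sum.inl l)) v
    obtain ⟨v₂, h₂⟩ := ih₂ M (fun l => emb (Sum.inr l)) exit (fun l => hM (Sum.inr l)) v₁
    exact ⟨v₂, h₁.trans h₂⟩
  | @iteTrue k f p q s t s' hf _ ih =>
    intro L M emb exit hM v
    obtain ⟨v₁, h₁⟩ := ih M (fun l => emb (some (Sum.inl l))) exit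
      (fun l => hM (some (Sum.inl l))) (s k).head?
    refine ⟨v₁, ?_⟩
    rw [add_comm]
    refine .trans (.one ?_) h₁
    rw [hM]
    simp [entry, compile, hf]
  | @iteFalse k f p q s t s' hf _ ih =>
    intro L M emb exit hM v
    obtain ⟨v₁, h₁⟩ := ih M (fun l => emb (some (Sum.inr l))) exit
      (fun l => hM (some (Sum.inr l))) (s k).head?
    refine ⟨v₁, ?_⟩
    rw [add_comm]
    refine .trans (.one ?_) h₁
    rw [hM]
    simp [entry, compile, hf]
  | @loopTrue k f p s t s' t' s'' hf _ _ ih₁ ih₂ =>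
    intro L M emb exit hM v
    obtain ⟨v₁, h₁⟩ := ih₁ M (fun l => emb (some l)) (emb none)
      (fun l => hM (some l)) (s k).head?
    obtain ⟨v₂, h₂⟩ := ih₂ M emb exit hM v₁
    refine ⟨v₂, ?_⟩
    rw [add_comm]
    refine .trans (.one ?_) (h₁.trans h₂)
    rw [hM]
    simp [entry, compile, hf]
  | @loopFalse k f p s hf =>
    refine fun M emb exit hM v => ⟨(s k).head?, .one ?_⟩
    rw [hM]
    simp [entry, compile, hf]

/-- The bundled machine of a program; input and output are on the stack `io`. -/
def toTM (p : Prog) : FinTM2 where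
  K := Stk
  k₀ := .io
  k₁ := .io
  Γ _ := Γ'
  Λ := Option (Lab p)
  main := some (entry p)
  σ := Option Γ'
  initialState := none
  -- The label `none` is the common exit. It resets the internal state, because a halting
  -- configuration must carry the initial one; this is the one step added to the time bound below.
  m l := Option.casesOn l (.load (fun _ => none) .halt) (compile p some none)

/-- The store with `w` on the stack `io` and all other stacks empty. -/
def ioStore (w : List Γ') : Store := Function.update (fun _ => []) .io w

theorem initList_toTM (p : Prog) (w : List Γ') :
    initList (toTM p) w = ⟨some (some (entry p)), none, ioStore w⟩ := by
  unfold initList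
  congr 1
  funext k
  cases k <;> rfl

theorem haltList_toTM (p : Prog) (w : List Γ') :
    haltList (toTM p) w = ⟨none, none, ioStore w⟩ := by
  unfold haltList
  congr 1
  funext k
  cases k <;> rfl

theorem nonempty_tm2ComputableInPolyTime {α β : Type} {ea : α → List Γ'} {eb : β → List Γ'}
    {f : α → β} (p : Prog) (P : Polynomial ℕ)
    (h : ∀ a, ∃ t ≤ P.eval (ea a).length, Exec p (ioStore (ea a)) t (ioStore (eb (f a)))) :
    Nonempty (TM2ComputableInPolyTime ea eb f) := by
  refine ⟨⟨⟨toTM p, Equiv.refl _, Equiv.refl _⟩, P + 1, fun a => ?_⟩⟩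
  have e₁ := (congrArg (initList (toTM p)) (List.map_id (ea a))).trans (initList_toTM p (ea a))
  have e₂ := (congrArg (haltList (toTM p)) (List.map_id (eb (f a)))).trans
    (haltList_toTM p (eb (f a)))
  have key : ∃ t, t ≤ (P + 1).eval (ea a).length ∧
      (flip bind (toTM p).step)^[t]
        (some (initList (toTM p) (List.map (Equiv.refl Γ').invFun (ea a)))) =
        some (haltList (toTM p) (List.map (Equiv.refl Γ').invFun (eb (f a)))) := by
    obtain ⟨t, ht, h⟩ := h a
    obtain ⟨v', hv⟩ := stepsTo_compile h (toTM p).m some none (fun l => rfl) none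
    refine ⟨t + 1, by simpa using ht, ?_⟩
    exact (congrArg (fun c => (flip bind (toTM p).step)^[t + 1] (some c)) e₁).trans
      (Eq.trans (hv.trans (.one rfl)) (congrArg some e₂.symm))
  exact ⟨⟨key.choose, key.choose_spec.2⟩, key.choose_spec.1⟩

/-! ### Binary trees on stacks -/

/-- `Run p s T s'`: started on `s`, the program `p` halts after at most `T` steps on `s'`. -/
def Run (p : Prog) (s : Store) (T : ℕ) (s' : Store) : Prop := ∃ t ≤ T, Exec p s t s'

theorem Run.mono {p : Prog} {s s' : Store} {T T' : ℕ} (h : Run p s T s') (hT : T ≤ T') :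
    Run p s T' s' :=
  let ⟨t, ht, h⟩ := h; ⟨t, ht.trans hT, h⟩

theorem Run.seq {p q : Prog} {s s' s'' : Store} {T T' : ℕ} (h : Run p s T s')
    (h' : Run q s' T' s'') : Run (p ;; q) s (T + T') s'' :=
  let ⟨t, ht, hp⟩ := h
  let ⟨t', ht', hq⟩ := h'
  ⟨t + t', add_le_add ht ht', hp.seq hq⟩

/-- Binary trees. -/
inductive DTree
  | nil
  | cons (a b : DTree)

/-- The word of a tree in prefix notation. -/
def DTree.code : DTree → List Γ'
  | .nil => [.bit false]
  | .cons a b => .bit true :: (a.code ++ b.code)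

/-- The number of nodes of a tree. -/
def DTree.size (d : DTree) : ℕ := d.code.length

@[simp] theorem DTree.size_nil : DTree.nil.size = 1 := rfl

@[simp] theorem DTree.size_cons (a b : DTree) : (DTree.cons a b).size = a.size + b.size + 1 := by
  simp [DTree.size, DTree.code]

theorem DTree.size_pos (d : DTree) : 0 < d.size := by cases d <;> simp

/-- The body of the loop that reads a tree. -/
def readBody (i : Stk) : Prog :=
  .ite i (fun o => o == some (.bit true)) (.push .cnt .blank) (.pop .cnt) ;; .move i [.rev]

/-- Pop a tree from `i` and leave its reversed word on `rev`; `cnt` counts the trees that are still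
to be read. -/
def readTree (i : Stk) : Prog :=
  .push .cnt .blank ;; .loop .cnt Option.isSome (readBody i)

/-- Replace the contents of the stacks `i`, `rev` and `cnt`. -/
def setTmp (i : Stk) (x r c : List Γ') (s : Store) : Store :=
  fun k => if k = i then x else if k = .rev then r else if k = .cnt then c else s k

/-- A leaf completes one pending tree, whereas a `cons` symbol replaces one pending tree by two:
hence the pop and the push on `cnt`. -/
theorem exec_readBody_nil {i : Stk} (hi : i ≠ .rev) (hi' : i ≠ .cnt) (x r c : List Γ') (y : Γ')
    (s : Store) : Exec (readBody i) (setTmp i (.bit false :: x) r (y :: c) s) 3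
      (setTmp i x (.bit false :: r) c s) := by
  have h₁ := Exec.iteFalse (k := i) (f := fun o => o == some (.bit true))
    (p := .push .cnt .blank) (s := setTmp i (.bit false :: x) r (y :: c) s)
    (by simp [setTmp]) (Exec.pop .cnt _)
  refine Exec.seq (t := 2) (t' := 1) h₁ ?_
  convert! Exec.move (i := i) (js := [.rev]) (c := .bit false) (r := x) (by simp) ?_ using 1
  · funext k
    by_cases hk : k = i
    · subst hk; simp [setTmp, pushAll, hi]
    · cases k <;> simp_all [setTmp, pushAll, Function.update]
  · simp [setTmp, hi']

theorem exec_readBody_cons {i : Stk} (hi : i ≠ .rev) (hi' : i ≠ .cnt) (x r c : List Γ')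
    (s : Store) : Exec (readBody i) (setTmp i (.bit true :: x) r c s) 3
      (setTmp i x (.bit true :: r) (.blank :: c) s) := by
  have h₁ := Exec.iteTrue (k := i) (f := fun o => o == some (.bit true))
    (q := .pop .cnt) (s := setTmp i (.bit true :: x) r c s)
    (by simp [setTmp]) (Exec.push .cnt .blank _)
  refine Exec.seq (t := 2) (t' := 1) h₁ ?_
  convert! Exec.move (i := i) (js := [.rev]) (c := .bit true) (r := x) (by simp) ?_ using 1
  · funext k
    by_cases hk : k = i
    · subst hk; simp [setTmp, pushAll, hi]
    · cases k <;> simp_all [setTmp, pushAll, Function.update]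
  · simp [setTmp, hi']

/-- The remaining run of the loop is a hypothesis, so that the two subtrees of a node can be chained
although the loop does not stop between them. Each symbol costs three steps for the body and one for
the test. -/
theorem exec_readLoop {i : Stk} (hi : i ≠ .rev) (hi' : i ≠ .cnt) (s : Store) :
    ∀ (d : DTree) (x r c : List Γ') (y : Γ') (t : ℕ) (s' : Store),
      Exec (.loop .cnt Option.isSome (readBody i)) (setTmp i x (d.code.reverse ++ r) c s) t s' →
      Exec (.loop .cnt Option.isSome (readBody i)) (setTmp i (d.code ++ x) r (y :: c) s)
        (4 * d.size + t) s'
  | .nil, x, r, c, y, t, s', h => by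
    have := Exec.loopTrue (f := Option.isSome) (k := .cnt) (by simp [setTmp, hi'.symm])
      (exec_readBody_nil hi hi' x r c y s) h
    convert! this using 1
    simp; ring
  | .cons a b, x, r, c, y, t, s', h => by
    have h₁ := exec_readLoop hi hi' s b x (a.code.reverse ++ (.bit true :: r)) c y t s'
      (by simpa [DTree.code] using h)
    have h₂ := exec_readLoop hi hi' s a (b.code ++ x) (.bit true :: r) (y :: c) .blank _ s' h₁
    have := Exec.loopTrue (f := Option.isSome) (k := .cnt) (by simp [setTmp, hi'.symm])
      (exec_readBody_cons hi hi' (a.code ++ (b.code ++ x)) r (y :: c) s) h₂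
    convert! this using 1
    · simp [DTree.code]
    · simp; ring

/-- Move the contents of `rev` to all stacks in `js`. -/
def unread (js : List Stk) : Prog := .loop .rev Option.isSome (.move .rev js)

theorem exec_unread {js : List Stk} (hjs : js.Nodup) (hr : .rev ∉ js) :
    ∀ (w : List Γ') (s : Store), s .rev = w → Exec (unread js) s (2 * w.length + 1)
      (fun k => if k = .rev then [] else if k ∈ js then w.reverse ++ s k else s k)
  | [], s, h => by
    convert! Exec.loopFalse (f := Option.isSome) (k := .rev) (s := s) (by simp [h]) using 1
    funext k
    by_cases hk : k = .rev
    · subst hk; simp [h]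
    · simp [hk]
  | c :: w, s, h => by
    have ih := exec_unread hjs hr w (pushAll c js (Function.update s .rev w))
      (by simp [pushAll, hr])
    have := Exec.loopTrue (f := Option.isSome) (k := .rev) (by simp [h])
      (Exec.move hjs h) ih
    convert! this using 1
    · simp; ring
    · funext k
      by_cases hk : k = .rev
      · simp [hk]
      · by_cases hk' : k ∈ js <;> simp [hk, hk', pushAll]

/-- Move the tree on top of `i` to the top of every stack in `js`. -/
def xfer (i : Stk) (js : List Stk) : Prog := readTree i ;; unread js

/-- The word is reversed onto `rev` and reversed back, at four plus two steps per symbol. With `i ∈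
js` the tree is copied, with `js = []` it is discarded. -/
theorem run_xfer {i : Stk} (hi : i ≠ .rev) (hi' : i ≠ .cnt) {js : List Stk} (hjs : js.Nodup)
    (hr : .rev ∉ js) {s : Store} {d : DTree} {x : List Γ'} (hs : s i = d.code ++ x)
    (hrev : s .rev = []) (hcnt : s .cnt = []) :
    Run (xfer i js) s (6 * d.size + 3) (fun k => (if k ∈ js then d.code else []) ++
      if k = i then x else s k) := by
  have h₁ : Exec (.push .cnt .blank) s 1 (setTmp i (d.code ++ x) [] [.blank] s) := by
    convert! Exec.push .cnt .blank s using 1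
    funext k
    by_cases hk : k = i
    · subst hk; simp [setTmp, hs, hi']
    · cases k <;> simp [setTmp, hk, hrev, hcnt, Function.update]
  have h₂ : Exec (.loop .cnt Option.isSome (readBody i))
      (setTmp i x (d.code.reverse ++ []) [] s) 1 (setTmp i x (d.code.reverse ++ []) [] s) :=
    Exec.loopFalse (f := Option.isSome) (k := .cnt) (by simp [setTmp, hi'.symm])
  have h₃ := exec_unread hjs hr d.code.reverse (setTmp i x (d.code.reverse ++ []) [] s)
    (by simp [setTmp, hi.symm])
  have h := (h₁.seq (exec_readLoop hi hi' s d x [] [] .blank 1 _ h₂)).seq h₃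
  refine ⟨1 + (4 * d.size + 1) + (2 * d.code.reverse.length + 1), ?_, ?_⟩
  · simp only [List.length_reverse, DTree.size]; omega
  · convert! h using 1
    funext k
    by_cases hk : k = i
    · subst hk; by_cases hk' : k ∈ js <;> simp [setTmp, hi, hk']
    · by_cases hk' : k ∈ js
      · have : k ≠ .rev := by rintro rfl; exact hr hk'
        by_cases hk'' : k = .cnt
        · subst hk''; simp [setTmp, hk, hk', hcnt]
        · simp [setTmp, hk, hk', this, hk'']
      · cases k <;> simp [setTmp, hk, hk', hrev, hcnt]

theorem run_xfer_eq {i : Stk} (hi : i ≠ .rev) (hi' : i ≠ .cnt) {js : List Stk} (hjs : js.Nodup)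
    (hr : .rev ∉ js) {s s' : Store} {d : DTree} {x : List Γ'} (hs : s i = d.code ++ x)
    (hrev : s .rev = []) (hcnt : s .cnt = [])
    (h : s' = fun k => (if k ∈ js then d.code else []) ++ if k = i then x else s k) :
    Run (xfer i js) s (6 * d.size + 3) s' :=
  h ▸ run_xfer hi hi' hjs hr hs hrev hcnt

/-- The word of a list of trees. -/
def codes (l : List DTree) : List Γ' := l.flatMap DTree.code

@[simp] theorem codes_nil : codes [] = [] := rfl

@[simp] theorem codes_cons (d : DTree) (l : List DTree) : codes (d :: l) = d.code ++ codes l := rfl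

/-- The store with the given trees on the data stacks, the other stacks being empty. -/
def treeStore (m a b : List DTree) : Store
  | .main => codes m
  | .aux => codes a
  | .alt => codes b
  | _ => []

section
variable (d e : DTree) (m a b : List DTree)

theorem run_pushNil : Run (.push .main (.bit false)) (treeStore m a b) 1
    (treeStore (.nil :: m) a b) := by
  refine ⟨1, le_rfl, ?_⟩
  convert! Exec.push .main (.bit false) (treeStore m a b) using 1
  funext k; cases k <;> rfl

theorem run_pushCons : Run (.push .main (.bit true)) (treeStore (d :: e :: m) a b) 1
    (treeStore (.cons d e :: m) a b) := by
  refine ⟨1, le_rfl, ?_⟩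
  convert! Exec.push .main (.bit true) _ using 1
  funext k; cases k <;> simp [treeStore, Function.update, DTree.code]

theorem run_popCons : Run (.pop .main) (treeStore (.cons d e :: m) a b) 1
    (treeStore (d :: e :: m) a b) := by
  refine ⟨1, le_rfl, ?_⟩
  convert! Exec.pop .main _ using 1
  funext k; cases k <;> simp [treeStore, Function.update, DTree.code]

theorem run_popNil : Run (.pop .main) (treeStore (.nil :: m) a b) 1 (treeStore m a b) := by
  refine ⟨1, le_rfl, ?_⟩
  convert! Exec.pop .main _ using 1
  funext k; cases k <;> simp [treeStore, Function.update, DTree.code]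

theorem run_popCons_alt : Run (.pop .alt) (treeStore m a (.cons d e :: b)) 1
    (treeStore m a (d :: e :: b)) := by
  refine ⟨1, le_rfl, ?_⟩
  convert! Exec.pop .alt _ using 1
  funext k; cases k <;> simp [treeStore, Function.update, DTree.code]

theorem run_popNil_alt : Run (.pop .alt) (treeStore m a (.nil :: b)) 1 (treeStore m a b) := by
  refine ⟨1, le_rfl, ?_⟩
  convert! Exec.pop .alt _ using 1
  funext k; cases k <;> simp [treeStore, Function.update, DTree.code]

theorem run_drop : Run (xfer .main []) (treeStore (d :: m) a b) (6 * d.size + 3)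
    (treeStore m a b) := by
  exact run_xfer_eq (x := codes m) (by decide) (by decide) (by decide) (by decide) rfl rfl rfl
    (by funext k; cases k <;> simp [treeStore])

theorem run_drop_aux : Run (xfer .aux []) (treeStore m (d :: a) b) (6 * d.size + 3)
    (treeStore m a b) := by
  exact run_xfer_eq (x := codes a) (by decide) (by decide) (by decide) (by decide) rfl rfl rfl
    (by funext k; cases k <;> simp [treeStore])

theorem run_copy_aux : Run (xfer .main [.main, .aux]) (treeStore (d :: m) a b) (6 * d.size + 3)
    (treeStore (d :: m) (d :: a) b) := by
  exact run_xfer_eq (x := codes m) (by decide) (by decide) (by decide) (by decide) rfl rfl rfl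
    (by funext k; cases k <;> simp [treeStore])

theorem run_copy_main : Run (xfer .aux [.main, .aux]) (treeStore m (d :: a) b) (6 * d.size + 3)
    (treeStore (d :: m) (d :: a) b) := by
  exact run_xfer_eq (x := codes a) (by decide) (by decide) (by decide) (by decide) rfl rfl rfl
    (by funext k; cases k <;> simp [treeStore])

theorem run_move_main_aux : Run (xfer .main [.aux]) (treeStore (d :: m) a b) (6 * d.size + 3)
    (treeStore m (d :: a) b) := by
  exact run_xfer_eq (x := codes m) (by decide) (by decide) (by decide) (by decide) rfl rfl rfl
    (by funext k; cases k <;> simp [treeStore])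

theorem run_move_aux_main : Run (xfer .aux [.main]) (treeStore m (d :: a) b) (6 * d.size + 3)
    (treeStore (d :: m) a b) := by
  exact run_xfer_eq (x := codes a) (by decide) (by decide) (by decide) (by decide) rfl rfl rfl
    (by funext k; cases k <;> simp [treeStore])

theorem run_move_main_alt : Run (xfer .main [.alt]) (treeStore (d :: m) a b) (6 * d.size + 3)
    (treeStore m a (d :: b)) := by
  exact run_xfer_eq (x := codes m) (by decide) (by decide) (by decide) (by decide) rfl rfl rfl
    (by funext k; cases k <;> simp [treeStore])

theorem run_move_alt_main : Run (xfer .alt [.main]) (treeStore m a (d :: b)) (6 * d.size + 3)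
    (treeStore (d :: m) a b) := by
  exact run_xfer_eq (x := codes b) (by decide) (by decide) (by decide) (by decide) rfl rfl rfl
    (by funext k; cases k <;> simp [treeStore])

end

/-- The test whether the tree on top of a stack is not `nil`. -/
def isCons (o : Option Γ') : Bool := o == some (.bit true)

/-! ### Functions computable in polynomial time on tree encodings -/

/-- Types whose elements are represented by trees. -/
class Enc (α : Type) where
  /-- The tree of an element. -/
  enc : α → DTree

open Enc (enc)

/-- The size of the tree of an element. -/
def esize {α : Type} [Enc α] (a : α) : ℕ := (enc a).size

theorem eval_mono (P : Polynomial ℕ) {m n : ℕ} (h : m ≤ n) : P.eval m ≤ P.eval n := by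
  simp only [Polynomial.eval_eq_sum, Polynomial.sum]
  gcongr

/-- `f` is bounded by a polynomial in the size of its argument. -/
def PolyBdd {α : Type} [Enc α] (f : α → ℕ) : Prop :=
  ∃ P : Polynomial ℕ, ∀ a, f a ≤ P.eval (esize a)

section PolyBdd
variable {α β : Type} [Enc α] [Enc β] {f g : α → ℕ}

theorem PolyBdd.mono (hg : PolyBdd g) (h : ∀ a, f a ≤ g a) : PolyBdd f :=
  let ⟨P, hP⟩ := hg; ⟨P, fun a => (h a).trans (hP a)⟩

theorem PolyBdd.const (n : ℕ) : PolyBdd (fun _ : α => n) := ⟨Polynomial.C n, fun a => by simp⟩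

theorem PolyBdd.add (hf : PolyBdd f) (hg : PolyBdd g) : PolyBdd (fun a => f a + g a) :=
  let ⟨P, hP⟩ := hf
  let ⟨Q, hQ⟩ := hg
  ⟨P + Q, fun a => by rw [Polynomial.eval_add]; exact add_le_add (hP a) (hQ a)⟩

theorem PolyBdd.mul (hf : PolyBdd f) (hg : PolyBdd g) : PolyBdd (fun a => f a * g a) :=
  let ⟨P, hP⟩ := hf
  let ⟨Q, hQ⟩ := hg
  ⟨P * Q, fun a => by rw [Polynomial.eval_mul]; exact Nat.mul_le_mul (hP a) (hQ a)⟩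

theorem PolyBdd.pow (hf : PolyBdd f) (n : ℕ) : PolyBdd (fun a => f a ^ n) :=
  let ⟨P, hP⟩ := hf
  ⟨P ^ n, fun a => by rw [Polynomial.eval_pow]; exact Nat.pow_le_pow_left (hP a) n⟩

theorem PolyBdd.eval (P : Polynomial ℕ) (hf : PolyBdd f) : PolyBdd (fun a => P.eval (f a)) :=
  let ⟨Q, hQ⟩ := hf
  ⟨P.comp Q, fun a => by rw [Polynomial.eval_comp]; exact eval_mono P (hQ a)⟩

theorem PolyBdd.esize : PolyBdd (fun a : α => esize a) := ⟨Polynomial.X, fun a => by simp⟩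

theorem PolyBdd.comp {g : β → ℕ} (hg : PolyBdd g) {h : α → β}
    (hh : PolyBdd fun a => LCSep.esize (h a)) : PolyBdd (fun a => g (h a)) :=
  let ⟨P, hP⟩ := hg
  (hh.eval P).mono fun a => hP (h a)

end PolyBdd

/-- `f` is computed in polynomial time on trees, by a program that works above arbitrary contents
of the data stacks. -/
def PT {α β : Type} [Enc α] [Enc β] (f : α → β) : Prop :=
  -- The bound on the output size is needed to bound the time of a second program run on that
  -- output. The arbitrary `m`, `a`, `b` allow data to be kept below the argument while a subprogram
  -- runs.
  ∃ (p : Prog) (T : α → ℕ), PolyBdd T ∧ PolyBdd (fun a => esize (f a)) ∧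
    ∀ x m a b, Run p (treeStore (enc x :: m) a b) (T x) (treeStore (enc (f x) :: m) a b)

instance : Enc Unit := ⟨fun _ => .nil⟩

instance : Enc Bool := ⟨fun b => cond b (.cons .nil .nil) .nil⟩

/-- The second component comes first, so that a pair is built by pushing one symbol once its
components have been computed in their order. -/
instance {α β : Type} [Enc α] [Enc β] : Enc (α × β) := ⟨fun x => .cons (enc x.2) (enc x.1)⟩

instance {α : Type} [Enc α] : Enc (List α) := ⟨List.foldr (fun a t => .cons (enc a) t) .nil⟩

/-- Natural numbers in unary. -/
instance : Enc ℕ := ⟨fun n => Nat.rec .nil (fun _ t => .cons .nil t) n⟩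

section sizes
variable {α β : Type} [Enc α] [Enc β]

theorem enc_cons (a : α) (l : List α) : enc (a :: l) = .cons (enc a) (enc l) := rfl

theorem esize_pos (a : α) : 0 < esize a := DTree.size_pos _

theorem esize_bool_le (b : Bool) : esize b ≤ 3 := by cases b <;> decide

@[simp] theorem esize_pair (x : α × β) : esize x = esize x.1 + esize x.2 + 1 := by
  simp only [esize, enc, DTree.size_cons]; ring

@[simp] theorem esize_nil : esize ([] : List α) = 1 := rfl

@[simp] theorem esize_cons (a : α) (l : List α) : esize (a :: l) = esize a + esize l + 1 := by
  simp [esize, enc_cons]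

@[simp] theorem esize_nat (n : ℕ) : esize n = 2 * n + 1 := by
  induction n with
  | zero => rfl
  | succ n ih =>
    have : esize (n + 1) = esize n + 2 := by
      simp only [esize, enc, DTree.size_cons, DTree.size_nil]; ring
    rw [this, ih]; ring

theorem esize_append (l l' : List α) : esize (l ++ l') + 1 = esize l + esize l' := by
  induction l with
  | nil => simp [add_comm]
  | cons a l ih => simp only [List.cons_append, esize_cons]; omega

theorem length_le_esize (l : List α) : l.length ≤ esize l := by
  induction l with
  | nil => simp
  | cons a l ih => simp only [List.length_cons, esize_cons]; omega

theorem esize_le_of_mem {a : α} {l : List α} (h : a ∈ l) : esize a ≤ esize l := by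
  induction l with
  | nil => simp at h
  | cons b l ih =>
    rcases List.mem_cons.1 h with rfl | h
    · simp; omega
    · have := ih h; simp; omega

theorem esize_prefix_le {l l' : List α} (h : l' <+: l) : esize l' ≤ esize l := by
  obtain ⟨t, rfl⟩ := h
  have := esize_append l' t
  have := esize_pos t
  omega

theorem esize_reverse (l : List α) : esize l.reverse = esize l := by
  induction l with
  | nil => rfl
  | cons a l ih =>
    have := esize_append l.reverse [a]
    simp only [List.reverse_cons, esize_cons, esize_nil] at *
    omega

theorem esize_list_le {l : List α} {B : ℕ} (h : ∀ a ∈ l, esize a ≤ B) :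
    esize l ≤ l.length * (B + 1) + 1 := by
  induction l with
  | nil => simp
  | cons a l ih =>
    have h₁ := ih fun a ha => h a (List.mem_cons_of_mem _ ha)
    have h₂ := h a List.mem_cons_self
    simp only [esize_cons, List.length_cons, add_mul]
    omega

end sizes

namespace PT
variable {α β γ δ : Type} [Enc α] [Enc β] [Enc γ] [Enc δ]

theorem bdd {f : α → β} (h : PT f) : PolyBdd (fun a => esize (f a)) :=
  let ⟨_, _, _, hf, _⟩ := h; hf

theorem comp {g : β → γ} {f : α → β} (hg : PT g) (hf : PT f) : PT (fun a => g (f a)) := by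
  obtain ⟨p, T, hT, hb, hp⟩ := hf
  obtain ⟨q, S, hS, hc, hq⟩ := hg
  exact ⟨p ;; q, fun a => T a + S (f a), hT.add (hS.comp hb), hc.comp hb,
    fun x m a b => (hp x m a b).seq (hq (f x) m a b)⟩

/-- A function that does not change the tree. -/
theorem of_enc_eq {f : α → β} (h : ∀ a, enc (f a) = enc a) : PT f := by
  -- A push followed by a pop serves as the empty program.
  refine ⟨.push .main (.bit false) ;; .pop .main, fun _ => 1 + 1, .const _, ?_, fun x m a b => ?_⟩
  · exact PolyBdd.esize.mono fun a => by simp [LCSep.esize, h]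
  · rw [h]
    exact (run_pushNil _ a b).seq (run_popNil _ _ _)

theorem id : PT (fun a : α => a) := of_enc_eq fun _ => rfl

theorem fst : PT (Prod.fst : α × β → α) := by
  refine ⟨.pop .main ;; xfer .main [], fun x => 1 + (6 * esize x + 3), ?_, ?_, fun x m a b => ?_⟩
  · exact (PolyBdd.const 1).add (((PolyBdd.const 6).mul .esize).add (.const 3))
  · exact PolyBdd.esize.mono fun a => by simp; omega
  · refine (run_popCons _ _ m a b).seq ((run_drop _ _ a b).mono ?_)
    have h := esize_pair x
    unfold LCSep.esize at *
    omega

/-- The second component lies on top, so it is parked on `aux` while the first is discarded. -/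
theorem snd : PT (Prod.snd : α × β → β) := by
  refine ⟨.pop .main ;; xfer .main [.aux] ;; xfer .main [] ;; xfer .aux [.main],
    fun x => 1 + ((6 * esize x + 3) + ((6 * esize x + 3) + (6 * esize x + 3))), ?_, ?_,
    fun x m a b => ?_⟩
  · have : PolyBdd fun x : α × β => 6 * esize x + 3 :=
      ((PolyBdd.const 6).mul .esize).add (.const 3)
    exact (PolyBdd.const 1).add (this.add (this.add this))
  · exact PolyBdd.esize.mono fun a => by simp; omega
  · have h := esize_pair x
    unfold LCSep.esize at h
    refine (run_popCons _ _ m a b).seq (((run_move_main_aux _ _ a b).mono ?_).seq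
      (((run_drop _ m _ b).mono ?_).seq ((run_move_aux_main _ m a b).mono ?_))) <;>
    · unfold LCSep.esize
      omega

theorem pair {f : α → β} {g : α → γ} (hf : PT f) (hg : PT g) : PT (fun a => (f a, g a)) := by
  obtain ⟨p, T, hT, hb, hp⟩ := hf
  obtain ⟨q, S, hS, hc, hq⟩ := hg
  have h6 : PolyBdd fun x : α => 6 * esize x + 3 := ((PolyBdd.const 6).mul .esize).add (.const 3)
  refine ⟨xfer .main [.main, .aux] ;; p ;; xfer .aux [.main] ;; q ;; .push .main (.bit true),
    fun x => (6 * esize x + 3) + (T x + ((6 * esize x + 3) + (S x + 1))), ?_, ?_,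
    fun x m a b => ?_⟩
  · exact h6.add (hT.add (h6.add (hS.add (.const 1))))
  · exact ((hb.add hc).add (.const 1)).mono fun a => by simp
  · exact (run_copy_aux _ m a b).seq ((hp x m _ b).seq ((run_move_aux_main _ _ a b).seq
      ((hq x _ a b).seq (run_pushCons _ _ m a b))))

/-- Case distinction on a Boolean. -/
theorem ite {c : α → Bool} {f g : α → β} (hc : PT c) (hf : PT f) (hg : PT g) :
    PT (fun a => if c a then f a else g a) := by
  obtain ⟨r, R, hR, hd, hr⟩ := pair PT.id hc
  obtain ⟨p, T, hT, hb, hp⟩ := hf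
  obtain ⟨q, S, hS, hc', hq⟩ := hg
  -- The word of `true` has three symbols and that of `false` one, hence the numbers of pops.
  refine ⟨r ;; .pop .main ;; .ite .main isCons
    (.pop .main ;; .pop .main ;; .pop .main ;; p) (.pop .main ;; q),
    fun x => R x + (1 + (T x + S x + 4)), ?_, ?_, fun x m a b => ?_⟩
  · exact hR.add ((PolyBdd.const 1).add ((hT.add hS).add (.const 4)))
  · exact (hb.add hc').mono fun a => by
      dsimp only
      split <;> omega
  · refine (hr x m a b).seq ((run_popCons _ _ m a b).seq ?_)
    dsimp only
    cases hx : c x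
    · obtain ⟨t, ht, h⟩ := (run_popNil (enc x :: m) a b).seq (hq x m a b)
      exact ⟨t + 1, by omega, Exec.iteFalse rfl h⟩
    · obtain ⟨t, ht, h⟩ := (run_popCons .nil .nil (enc x :: m) a b).seq
        ((run_popNil _ a b).seq ((run_popNil _ a b).seq (hp x m a b)))
      exact ⟨t + 1, by omega, Exec.iteTrue rfl h⟩

/-- Case distinction on a list. -/
theorem list_cases {l : α → List β} {f : α → γ} {g : α → List β → β → γ} {h : α → γ} (hl : PT l)
    (hf : PT f) (hg : PT fun x : α × List β × β => g x.1 x.2.1 x.2.2)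
    (h_nil : ∀ a, l a = [] → h a = f a) (h_cons : ∀ a b t, l a = b :: t → h a = g a t b) :
    PT h := by
  obtain ⟨r, R, hR, hd, hr⟩ := pair PT.id hl
  obtain ⟨p, T, hT, hb, hp⟩ := hf
  obtain ⟨q, S, ⟨P, hS⟩, ⟨Q, hQ⟩, hq⟩ := hg
  have hs : ∀ a b t, l a = b :: t → esize (a, (t, b)) = esize a + esize (l a) + 1 := by
    intro a b t h; simp [h]; ring
  have h1 : PolyBdd fun x : α => esize x + esize (l x) + 1 :=
    (PolyBdd.esize.add hl.bdd).add (.const 1)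
  -- For a nonempty list, popping its `cons` symbol leaves head, tail and argument on top of each
  -- other. Two new `cons` symbols make them the tree of `(x, (t, y))`, which explains the argument
  -- order of `g`.
  refine ⟨r ;; .pop .main ;; .ite .main isCons
    (.pop .main ;; .push .main (.bit true) ;; .push .main (.bit true) ;; q) (.pop .main ;; p),
    fun x => R x + (1 + (T x + P.eval (esize x + esize (l x) + 1) + 4)), ?_, ?_, fun x m a b => ?_⟩
  · exact hR.add ((PolyBdd.const 1).add ((hT.add (h1.eval P)).add (.const 4)))
  · refine (hb.add (h1.eval Q)).mono fun a => ?_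
    rcases hx : l a with _ | ⟨b, t⟩
    · rw [h_nil a hx]; omega
    · have := hQ (a, (t, b))
      rw [hs a b t hx, hx] at this
      rw [h_cons a b t hx]; dsimp only at this; omega
  · refine (hr x m a b).seq ((run_popCons _ _ m a b).seq ?_)
    dsimp only
    rcases hx : l x with _ | ⟨y, t⟩
    · obtain ⟨n, hn, h⟩ := (run_popNil (enc x :: m) a b).seq (hp x m a b)
      rw [h_nil x hx]
      exact ⟨n + 1, by omega, Exec.iteFalse rfl h⟩
    · obtain ⟨n, hn, h⟩ := (run_popCons (enc y) (enc t) (enc x :: m) a b).seq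
        ((run_pushCons _ _ _ a b).seq ((run_pushCons _ _ _ a b).seq (hq (x, (t, y)) m a b)))
      rw [h_cons x y t hx]
      refine ⟨n + 1, ?_, Exec.iteTrue rfl h⟩
      have := hS (x, (t, y))
      rw [hs x y t hx, hx] at this
      omega

/-- The accumulator lives on `main`, the parameter `x` on `aux` and the rest of the list on `alt`.
`τ` bounds one pass through the body and is required only for accumulators that actually arise. The
constant 9 collects two transfers at 3 each, one pop and two pushes. -/
theorem run_foldl {step : (γ × β) × α → γ} {q : Prog} {S : (γ × β) × α → ℕ}
    (hq : ∀ x m a b, Run q (treeStore (enc x :: m) a b) (S x) (treeStore (enc (step x) :: m) a b))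
    (x : α) (m a b : List DTree) (τ : ℕ) :
    ∀ (l : List β) (s : γ),
      (∀ l' y, l' ++ [y] <+: l →
        S ((l'.foldl (fun s y => step ((s, y), x)) s, y), x) + 6 * esize y + 6 * esize x + 9 ≤ τ) →
      Run (.loop .alt isCons (.pop .alt ;; xfer .alt [.main] ;; .push .main (.bit true) ;;
        xfer .aux [.main, .aux] ;; .push .main (.bit true) ;; q))
        (treeStore (enc s :: m) (enc x :: a) (enc l :: b)) (l.length * (τ + 1) + 1)
        (treeStore (enc (l.foldl (fun s y => step ((s, y), x)) s) :: m) (enc x :: a)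
          (enc ([] : List β) :: b))
  | [], s, _ => ⟨1, by simp, Exec.loopFalse rfl⟩
  | y :: l, s, h => by
    obtain ⟨n, hn, ih⟩ := run_foldl hq x m a b τ l (step ((s, y), x)) fun l' z hl => by
      have := h (y :: l') z (by simpa using hl)
      simpa using this
    have h₀ := h [] y (by simp)
    obtain ⟨n', hn', hx⟩ := (run_popCons_alt (enc y) (enc l) (enc s :: m) (enc x :: a) b).seq
      ((run_move_alt_main (enc y) (enc s :: m) (enc x :: a) (enc l :: b)).seq
      ((run_pushCons _ _ m (enc x :: a) (enc l :: b)).seq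
      ((run_copy_main (enc x) (enc (s, y) :: m) a (enc l :: b)).seq
      ((run_pushCons _ _ m (enc x :: a) (enc l :: b)).seq
      (hq ((s, y), x) m (enc x :: a) (enc l :: b))))))
    refine ⟨n' + n + 1, ?_, Exec.loopTrue rfl hx ih⟩
    simp only [List.foldl_nil, LCSep.esize, List.length_cons, add_mul] at *
    omega

/-- Iterating a polynomial-time step may produce exponentially large data, so a polynomial bound `B`
on all intermediate accumulators has to be supplied. -/
theorem foldl {l : α → List β} {init : α → γ} {step : α → γ → β → γ} (hl : PT l) (hi : PT init)
    (hs : PT fun x : (γ × β) × α => step x.2 x.1.1 x.1.2) {B : α → ℕ} (hB : PolyBdd B)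
    (h : ∀ a l', l' <+: l a → esize (l'.foldl (step a) (init a)) ≤ B a) :
    PT (fun a => (l a).foldl (step a) (init a)) := by
  have hlb := hl.bdd
  obtain ⟨p, T, hT, -, hp⟩ := hl
  obtain ⟨r, R, hR, -, hr⟩ := hi
  obtain ⟨q, S, ⟨P, hS⟩, -, hq⟩ := hs
  have h6 : PolyBdd fun x : α => 6 * esize x + 3 := ((PolyBdd.const 6).mul .esize).add (.const 3)
  have h6l : PolyBdd fun x : α => 6 * esize (l x) + 3 := ((PolyBdd.const 6).mul hlb).add (.const 3)
  let τ : α → ℕ := fun x => P.eval (B x + esize (l x) + esize x + 2) + (6 * esize (l x) + 3) +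
    (6 * esize x + 3) + 3
  have hτ : PolyBdd τ :=
    (((((hB.add hlb).add .esize).add (.const 2)).eval P |>.add h6l).add h6).add (.const 3)
  refine ⟨xfer .main [.main, .aux] ;; p ;; xfer .main [.alt] ;; xfer .aux [.main, .aux] ;; r ;;
    (.loop .alt isCons (.pop .alt ;; xfer .alt [.main] ;; .push .main (.bit true) ;;
        xfer .aux [.main, .aux] ;; .push .main (.bit true) ;; q)) ;; .pop .alt ;; xfer .aux [],
    fun x => (6 * esize x + 3) + (T x + ((6 * esize (l x) + 3) + ((6 * esize x + 3) + (R x +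
      ((esize (l x) * (τ x + 1) + 1) + (1 + (6 * esize x + 3))))))), ?_, ?_, fun x m a b => ?_⟩
  · exact h6.add (hT.add (h6l.add (h6.add (hR.add (((hlb.mul (hτ.add (.const 1))).add
      (.const 1)).add ((PolyBdd.const 1).add h6))))))
  · exact hB.mono fun a => h a _ List.prefix_rfl
  · refine (run_copy_aux _ m a b).seq ((hp x m _ b).seq ((run_move_main_alt _ m _ b).seq
      ((run_copy_main _ m a _).seq ((hr x m _ _).seq (Run.seq (Run.mono
      (run_foldl hq x m a b (τ x) (l x) (init x) ?_) ?_)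
      ((run_popNil_alt _ _ b).seq (run_drop_aux _ _ a b)))))))
    · intro l' y hl'
      have h₁ := h x l' (((List.prefix_append l' [y]).trans hl'))
      have h₂ : esize y ≤ esize (l x) :=
        esize_le_of_mem (hl'.subset (by simp))
      have h₃ := hS ((l'.foldl (step x) (init x), y), x)
      have h₄ := eval_mono P (show esize ((l'.foldl (step x) (init x), y), x) ≤
        B x + esize (l x) + esize x + 2 by simp only [esize_pair]; omega)
      change S ((l'.foldl (step x) (init x), y), x) + 6 * esize y + 6 * esize x + 9 ≤ τ x
      simp only [τ]
      omega
    · gcongr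
      exact length_le_esize _

end PT

/-! ### Constants, list operations and unary arithmetic in polynomial time. -/

/-- Push a fixed tree. -/
def build : DTree → Prog
  | .nil => .push .main (.bit false)
  | .cons a b => build b ;; build a ;; .push .main (.bit true)

theorem exec_build (d : DTree) (s : Store) :
    Exec (build d) s d.size (Function.update s .main (d.code ++ s .main)) := by
  induction d generalizing s with
  | nil => exact Exec.push _ _ _
  | cons a b iha ihb =>
    have := (ihb s).seq ((iha _).seq (Exec.push .main (.bit true) _))
    convert! this using 1
    · simp; ring
    · funext k; cases k <;> simp [DTree.code, Function.update]

namespace PT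
variable {α β γ δ : Type} [Enc α] [Enc β] [Enc γ] [Enc δ]

theorem const (c : β) : PT (fun _ : α => c) := by
  refine ⟨xfer .main [] ;; build (enc c), fun x => (6 * esize x + 3) + (enc c).size, ?_,
    .const _, fun x m a b => ?_⟩
  · exact (((PolyBdd.const 6).mul .esize).add (.const 3)).add (.const _)
  · refine (run_drop _ m a b).seq ⟨_, le_rfl, ?_⟩
    convert! exec_build (enc c) (treeStore m a b) using 1
    funext k; cases k <;> simp [treeStore, Function.update]

theorem cons {f : α → β} {g : α → List β} (hf : PT f) (hg : PT g) :
    PT (fun a => f a :: g a) :=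
  (of_enc_eq (f := fun x : List β × β => x.2 :: x.1) fun _ => rfl).comp (hg.pair hf)

theorem reverse {l : α → List β} (hl : PT l) : PT (fun a => (l a).reverse) := by
  have e : ∀ l : List β, l.foldl (fun s y => y :: s) [] = l.reverse := by
    intro l; simp
  have h := foldl (step := fun _ s y => y :: s) hl (const []) (cons (snd.comp fst) (fst.comp fst))
    hl.bdd fun a l' hl' => by
      rw [e, esize_reverse]
      exact esize_prefix_le hl'
  simpa only [e] using h

theorem append {l l' : α → List β} (hl : PT l) (hl' : PT l') : PT (fun a => l a ++ l' a) := by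
  have e : ∀ l l' : List β, l.foldl (fun s y => y :: s) l' = l.reverse ++ l' := by
    intro l l'; simp
  have h := foldl (step := fun _ s y => y :: s) hl.reverse hl' (cons (snd.comp fst) (fst.comp fst))
    (hl.bdd.add hl'.bdd) fun a t ht => by
      have h₁ := esize_append t.reverse (l' a)
      have h₂ := esize_prefix_le ht
      simp only [e, esize_reverse] at *
      omega
  simpa only [e, List.reverse_reverse] using h

theorem flatMap {l : α → List β} {f : α → β → List γ} (hl : PT l)
    (hf : PT fun x : α × β => f x.1 x.2) : PT (fun a => (l a).flatMap (f a)) := by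
  have e : ∀ (g : β → List γ) (l : List β) (s : List γ),
      l.foldl (fun s y => s ++ g y) s = s ++ l.flatMap g := by
    intro g l
    induction l with
    | nil => simp
    | cons y l ih => intro s; simp [ih]
  obtain ⟨P, hP⟩ := hf.bdd
  have h := foldl (step := fun a s y => s ++ f a y) hl (const [])
    ((fst.comp fst).append (hf.comp (snd.pair (snd.comp fst))))
    (B := fun a => esize (l a) * P.eval (esize a + esize (l a) + 1) + 1)
    ((hl.bdd.mul (((PolyBdd.esize.add hl.bdd).add (.const 1)).eval P)).add (.const 1))
    fun a t ht => by
      rw [e, List.nil_append]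
      have h₁ : ∀ t : List β, (∀ y ∈ t, y ∈ l a) →
          esize (t.flatMap (f a)) ≤ t.length * P.eval (esize a + esize (l a) + 1) + 1 := by
        intro t
        induction t with
        | nil => simp
        | cons y t ih =>
          intro h
          have h₁ := ih fun z hz => h z (List.mem_cons_of_mem _ hz)
          have h₂ := esize_append (f a y) (t.flatMap (f a))
          have h₃ := hP (a, y)
          have h₄ := eval_mono P (show esize (a, y) ≤ esize a + esize (l a) + 1 by
            have := esize_le_of_mem (h y List.mem_cons_self)
            simp only [esize_pair]; omega)
          simp only [List.flatMap_cons, List.length_cons, add_mul]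
          dsimp only at h₃
          omega
      refine (h₁ t fun y hy => ht.subset hy).trans ?_
      gcongr
      exact ht.length_le.trans (length_le_esize _)
  simpa only [e, List.nil_append] using h

theorem map {l : α → List β} {f : α → β → γ} (hl : PT l)
    (hf : PT fun x : α × β => f x.1 x.2) : PT (fun a => (l a).map (f a)) := by
  have := hl.flatMap (f := fun a b => [f a b]) (hf.cons (const []))
  simpa only [List.map_eq_flatMap] using this

theorem isEmpty {l : α → List β} (hl : PT l) : PT (fun a => (l a).isEmpty) :=
  hl.list_cases (f := fun _ => true) (g := fun _ _ _ => false) (const _) (const _)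
    (fun a h => by simp [h]) (fun a b t h => by simp [h])

theorem not {c : α → Bool} (hc : PT c) : PT (fun a => !c a) := by
  have := hc.ite (const false) (const true)
  convert! this using 2 with a
  cases c a <;> rfl

theorem and {c d : α → Bool} (hc : PT c) (hd : PT d) : PT (fun a => c a && d a) := by
  have := hc.ite hd (const false)
  convert! this using 2 with a
  cases c a <;> rfl

/-- Every violation contributes one unit to a list, which is then tested for emptiness. -/
theorem all {l : α → List β} {p : α → β → Bool} (hl : PT l)
    (hp : PT fun x : α × β => p x.1 x.2) : PT (fun a => (l a).all (p a)) := by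
  have := (hl.flatMap (f := fun a b => if p a b then [] else [()])
    (hp.ite (const []) (const [()]))).isEmpty
  convert! this using 2 with a
  induction l a with
  | nil => rfl
  | cons b t ih => cases h : p a b <;> simp [h, ih]

theorem any {l : α → List β} {p : α → β → Bool} (hl : PT l)
    (hp : PT fun x : α × β => p x.1 x.2) : PT (fun a => (l a).any (p a)) := by
  have := (hl.all (p := fun a b => !p a b) hp.not).not
  simpa [List.not_all_eq_any_not] using this

/-- A fold over the first list, whose accumulator holds the pairs found so far, in reverse, and the
unused rest of the second list. -/
theorem zip {l : α → List β} {r : α → List γ} (hl : PT l) (hr : PT r) :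
    PT (fun a => (l a).zip (r a)) := by
  let step : List (β × γ) × List γ → β → List (β × γ) × List γ := fun s y =>
    match s.2 with
    | [] => s
    | z :: t => ((y, z) :: s.1, t)
  have e : ∀ (l : List β) (s : List (β × γ)) (r : List γ),
      l.foldl step (s, r) = ((l.zip r).reverse ++ s, r.drop l.length) := by
    intro l
    induction l with
    | nil => simp
    | cons y l ih =>
      intro s r
      cases r with
      | nil => simp [step, ih]
      | cons z t => simp [step, ih]
  have hs : PT fun x : ((List (β × γ) × List γ) × β) × α => step x.1.1 x.1.2 := by
    refine list_cases (l := fun x : ((List (β × γ) × List γ) × β) × α => x.1.1.2)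
      (f := fun x => x.1.1) (g := fun x t z => ((x.1.2, z) :: x.1.1.1, t))
      (snd.comp (fst.comp fst)) (fst.comp fst) ?_ ?_ ?_
    · exact pair (cons (pair (snd.comp (fst.comp fst)) (snd.comp snd))
        (fst.comp (fst.comp (fst.comp fst)))) (fst.comp snd)
    · intro a h; simp [step, h]
    · intro a z t h; simp [step, h]
  have hz : ∀ (l : List β) (r : List γ), esize (l.zip r) ≤ 2 * esize l + 2 * esize r := by
    intro l
    induction l with
    | nil => intro r; simp; omega
    | cons y l ih =>
      intro r
      cases r with
      | nil => simp
      | cons z r => have := ih r; simp; omega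
  have hd : ∀ (r : List γ) n, esize (r.drop n) ≤ esize r := by
    intro r n
    have := esize_append (r.take n) (r.drop n)
    rw [List.take_append_drop] at this
    have := esize_pos (r.take n)
    omega
  have h := foldl (step := fun _ => step) hl ((const []).pair hr) hs
    (B := fun a => 2 * esize (l a) + 2 * esize (r a) + esize (r a) + 1)
    (((((PolyBdd.const 2).mul hl.bdd).add ((PolyBdd.const 2).mul hr.bdd)).add hr.bdd).add
      (.const 1))
    fun a t ht => by
      have h₁ := hz t (r a)
      have h₂ := esize_prefix_le ht
      have h₃ := hd (r a) t.length
      rw [e]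
      simp only [List.append_nil, esize_pair, esize_reverse]
      omega
  have := (fst.comp h).reverse
  simpa only [e, List.append_nil, List.reverse_reverse] using this

theorem succ {n : α → ℕ} (hn : PT n) : PT (fun a => n a + 1) :=
  (of_enc_eq (f := fun x : ℕ × Unit => x.1 + 1) fun _ => rfl).comp (hn.pair (const ()))

/-- A unary number and a list of that many units have the same tree; in this way folds become loops
over numbers. -/
theorem replicate_unit {n : α → ℕ} (hn : PT n) : PT (fun a => List.replicate (n a) ()) := by
  refine (of_enc_eq (f := fun n : ℕ => List.replicate n ()) fun n => ?_).comp hn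
  induction n with
  | zero => rfl
  | succ n ih => rw [List.replicate_succ, enc_cons, ih]; rfl

theorem length {l : α → List β} (hl : PT l) : PT (fun a => (l a).length) := by
  have e : ∀ (l : List β) n, l.foldl (fun n _ => n + 1) n = n + l.length := by
    intro l
    induction l with
    | nil => simp
    | cons y l ih => intro n; simp [ih]; ring
  have h := foldl (step := fun _ n _ => n + 1) hl (const 0) (fst.comp fst).succ
    (((PolyBdd.const 2).mul hl.bdd).add (.const 1)) fun a t ht => by
      have := ht.length_le.trans (length_le_esize _)
      rw [e, esize_nat]
      omega
  simpa only [e, zero_add] using h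

theorem nat_cases {n : α → ℕ} {f : α → β} {g : α → ℕ → β} {h : α → β} (hn : PT n)
    (hf : PT f) (hg : PT fun x : α × ℕ => g x.1 x.2)
    (h_zero : ∀ a, n a = 0 → h a = f a) (h_succ : ∀ a k, n a = k + 1 → h a = g a k) : PT h := by
  refine hn.replicate_unit.list_cases (g := fun a t _ => g a t.length) hf
    (hg.comp (fst.pair (length (fst.comp snd)))) (fun a h => h_zero a (by simpa using h)) ?_
  intro a b t h
  have h' := congrArg List.length h
  exact h_succ a t.length (by simpa using h')

theorem pred {n : α → ℕ} (hn : PT n) : PT (fun a => n a - 1) :=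
  hn.nat_cases (g := fun _ k => k) (const 0) snd (fun a h => by simp [h]) (fun a k h => by simp [h])

theorem add {m n : α → ℕ} (hm : PT m) (hn : PT n) : PT (fun a => m a + n a) := by
  have := (hm.replicate_unit.append hn.replicate_unit).length
  simpa using this

theorem sub {m n : α → ℕ} (hm : PT m) (hn : PT n) : PT (fun a => m a - n a) := by
  have e : ∀ (l : List Unit) m, l.foldl (fun n _ => n - 1) m = m - l.length := by
    intro l
    induction l with
    | nil => simp
    | cons y l ih => intro n; simp [ih]; omega
  have h := foldl (step := fun _ n _ => n - 1) hn.replicate_unit hm (fst.comp fst).pred hm.bdd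
    fun a t ht => by
      rw [e, esize_nat, esize_nat]
      omega
  simpa only [e, List.length_replicate] using h

theorem lt {m n : α → ℕ} (hm : PT m) (hn : PT n) : PT (fun a => decide (m a < n a)) :=
  (hn.sub hm).nat_cases (f := fun _ => false) (g := fun _ _ => true) (const _) (const _)
    (fun a h => by simp; omega) (fun a k h => by simp; omega)

end PT

/-! ### Words on the input and output stack -/

/-- The symbols in the order of their numbers. -/
def symbols : List Γ' := [.bit false, .bit true, .comma, .ket, .bra, .blank]

theorem mem_symbols (c : Γ') : c ∈ symbols := by rcases c with _ | (_ | _) | _ | _ | _ <;> decide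

instance : Enc Γ' := ⟨fun c => enc (symbols.idxOf c)⟩

theorem enc_symbol (c : Γ') : enc c = enc (symbols.idxOf c) := rfl

theorem esize_symbol_le (c : Γ') : esize c ≤ 11 := by
  have h : symbols.idxOf c < 6 := List.idxOf_lt_length_of_mem (mem_symbols c)
  have : esize c = esize (symbols.idxOf c) := rfl
  rw [this, esize_nat]
  omega

/-- The store with trees `m` on `main` and the word `w` on `io`. -/
def wordStore (m : List DTree) (w : List Γ') : Store
  | .main => codes m
  | .io => w
  | _ => []

/-- Replace the symbol on top of `io`, if it is among `cs`, by its tree on top of `main`, and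
combine it with the tree below. -/
def readSymbol : List Γ' → Prog
  -- An arbitrary program: this case is never reached when the symbol occurs in the list.
  | [] => .pop .cnt
  | c :: cs => .ite .io (fun o => o == some c)
      (.pop .io ;; build (enc c) ;; .push .main (.bit true)) (readSymbol cs)

theorem run_readSymbol (c : Γ') (d : DTree) (w : List Γ') (cs : List Γ') (hc : c ∈ cs) :
    Run (readSymbol cs) (wordStore [d] (c :: w)) (cs.length + 13)
      (wordStore [.cons (enc c) d] w) := by
  induction cs with
  | nil => simp at hc
  | cons c' cs ih =>
    by_cases h : c = c'
    · subst h
      have h₁ := (Exec.pop .io (wordStore [d] (c :: w))).seq ((exec_build (enc c) _).seq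
        (Exec.push .main (.bit true) _))
      refine ⟨1 + ((enc c).size + 1) + 1, ?_, Exec.iteTrue (by simp [wordStore]) ?_⟩
      · have := esize_symbol_le c
        unfold esize at this
        simp; omega
      · convert! h₁ using 1
        funext k; cases k <;> simp [wordStore, Function.update, DTree.code]
    · obtain ⟨t, ht, hrun⟩ := ih (by simpa [h] using hc)
      exact ⟨t + 1, by simp; omega, Exec.iteFalse (by simp [wordStore, h]) hrun⟩

/-- Turn the word on `io` into the tree of the reversed list. -/
def readWord : Prog :=
  .push .main (.bit false) ;; .loop .io Option.isSome (readSymbol symbols)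

theorem run_readWord (w : List Γ') :
    Run readWord (ioStore w) (20 * w.length + 2) (wordStore [enc w.reverse] []) := by
  have h : ∀ w s : List Γ', Run (.loop .io Option.isSome (readSymbol symbols))
      (wordStore [enc s] w) (20 * w.length + 1) (wordStore [enc (w.reverse ++ s)] []) := by
    intro w
    induction w with
    | nil => exact fun s => ⟨1, by simp, Exec.loopFalse rfl⟩
    | cons c w ih =>
      intro s
      obtain ⟨t, ht, h₁⟩ := run_readSymbol c (enc s) w symbols (mem_symbols c)
      obtain ⟨t', ht', h₂⟩ := ih (c :: s)
      refine ⟨t + t' + 1, ?_, Exec.loopTrue rfl h₁ (by simpa [enc_cons] using h₂)⟩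
      simp [symbols] at *; omega
  have h₀ : Run (.push .main (.bit false)) (ioStore w) 1 (wordStore [enc ([] : List Γ')] w) := by
    refine ⟨1, le_rfl, ?_⟩
    convert! Exec.push .main (.bit false) (ioStore w) using 1
    funext k; cases k <;> rfl
  have := h₀.seq (h w [])
  rw [List.append_nil] at this
  exact this.mono (by omega)

/-- Replace the number on top of `main` by the symbol of this number on `io`. -/
def writeSymbol : List Γ' → Prog
  | [] => .pop .cnt
  -- A successor has the tree `cons nil t`, so lowering the number by one takes two pops.
  | c :: cs => .ite .main isCons (.pop .main ;; .pop .main ;; writeSymbol cs)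
      (.pop .main ;; .push .io c)

theorem run_writeSymbol (m : List DTree) (w : List Γ') (c : Γ') (cs : List Γ') (hc : c ∈ cs) :
    Run (writeSymbol cs) (wordStore (enc (cs.idxOf c) :: m) w) (3 * cs.length)
      (wordStore m (c :: w)) := by
  induction cs with
  | nil => simp at hc
  | cons c' cs ih =>
    by_cases h : c' = c
    · subst h
      rw [List.idxOf_cons_self]
      refine ⟨1 + 1 + 1, by simp, Exec.iteFalse rfl ?_⟩
      convert! (Exec.pop .main (wordStore (enc 0 :: m) w)).seq (Exec.push .io c' _) using 1
      funext k; cases k <;> rfl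
    · obtain ⟨t, ht, h'⟩ := ih (by simpa [Ne.symm h] using hc)
      rw [List.idxOf_cons_ne _ h]
      refine ⟨1 + (1 + t) + 1, by simp; omega, Exec.iteTrue rfl ?_⟩
      refine (Exec.pop .main _).seq ((Exec.pop .main _).seq ?_)
      convert! h' using 1
      funext k; cases k <;> rfl

/-- Turn the tree of a list of symbols into the reversed word on `io`. -/
def writeWord : Prog :=
  .loop .main isCons (.pop .main ;; writeSymbol symbols) ;; .pop .main

theorem run_writeWord (l : List Γ') :
    Run writeWord (wordStore [enc l] []) (20 * l.length + 2) (ioStore l.reverse) := by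
  have h : ∀ l w : List Γ', Run (.loop .main isCons (.pop .main ;; writeSymbol symbols))
      (wordStore [enc l] w) (20 * l.length + 1)
      (wordStore [enc ([] : List Γ')] (l.reverse ++ w)) := by
    intro l
    induction l with
    | nil => exact fun w => ⟨1, by simp, Exec.loopFalse rfl⟩
    | cons c l ih =>
      intro w
      obtain ⟨t, ht, h₁⟩ := run_writeSymbol [enc l] w c symbols (mem_symbols c)
      obtain ⟨t', ht', h₂⟩ := ih (c :: w)
      refine ⟨1 + t + t' + 1, ?_, Exec.loopTrue rfl ((Exec.pop .main _).seq ?_)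
        (by simpa using h₂)⟩
      · simp [symbols] at *; omega
      · convert! h₁ using 1
        funext k
        cases k <;> simp [wordStore, Function.update, enc_cons, enc_symbol, DTree.code]
  have h₀ : Run (.pop .main) (wordStore [enc ([] : List Γ')] l.reverse) 1
      (ioStore l.reverse) := by
    refine ⟨1, le_rfl, ?_⟩
    convert! Exec.pop .main (wordStore [enc ([] : List Γ')] l.reverse) using 1
    funext k; cases k <;> rfl
  have := h l []
  rw [List.append_nil] at this
  exact (this.seq h₀).mono (by omega)

/-- Polynomial time on trees implies polynomial time on words. -/
theorem PT.nonempty_tm2ComputableInPolyTime {α β : Type} [Enc α] {ea : α → List Γ'}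
    {eb : β → List Γ'} {f : α → β} (hea : ∀ a, enc a = enc (ea a).reverse)
    (h : PT fun a => (eb (f a)).reverse) : Nonempty (TM2ComputableInPolyTime ea eb f) := by
  obtain ⟨p, T, ⟨P, hP⟩, ⟨Q, hQ⟩, hp⟩ := h
  -- A symbol has a tree of at most 11 nodes, and its list cell adds one.
  have hs : ∀ a, esize a ≤ 12 * (ea a).length + 1 := fun a => by
    have := esize_list_le (l := (ea a).reverse) fun c _ => esize_symbol_le c
    have e : esize a = esize (ea a).reverse := by rw [esize, hea]; rfl
    rw [List.length_reverse] at this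
    omega
  refine LCSep.nonempty_tm2ComputableInPolyTime (readWord ;; p ;; writeWord)
    ((20 * .X + 2) + (P.comp (12 * .X + 1) + (20 * Q.comp (12 * .X + 1) + 2))) fun a => ?_
  have h₁ := run_readWord (ea a)
  have e : ∀ d : DTree, wordStore [d] [] = treeStore [d] [] [] := by
    intro d; funext k; cases k <;> rfl
  have h₂ := hp a [] [] []
  rw [hea, ← e, ← e] at h₂
  have h₃ := run_writeWord (eb (f a)).reverse
  rw [List.reverse_reverse] at h₃
  refine (h₁.seq (h₂.seq h₃)).mono ?_
  have h₄ := (hP a).trans (eval_mono P (hs a))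
  have h₅ := ((length_le_esize _).trans (hQ a)).trans (eval_mono Q (hs a))
  simp only [Polynomial.eval_add, Polynomial.eval_mul, Polynomial.eval_comp, Polynomial.eval_X,
    Polynomial.eval_one, Polynomial.eval_ofNat]
  dsimp only at h₅
  omega

/-! ### Cuts of separable sequences -/

/-- No four positions in `[s, t)` carry the pattern `2413` or `3142`. -/
def Avoids (v : ℕ → ℤ) (s t : ℕ) : Prop :=
  ∀ a b c d, s ≤ a → a < b → b < c → c < d → d < t →
    ¬ (v c < v a ∧ v a < v d ∧ v d < v b) ∧ ¬ (v b < v d ∧ v d < v a ∧ v a < v c)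

/-- The values on `[s, m)` are smaller than those on `[m, t)`. -/
def Cut (v : ℕ → ℤ) (s m t : ℕ) : Prop :=
  ∀ x y, s ≤ x → x < m → m ≤ y → y < t → v x < v y

/-- Negating the values exchanges 2413 and 3142. -/
theorem Avoids.neg {v : ℕ → ℤ} {s t : ℕ} (h : Avoids v s t) : Avoids (fun x => -v x) s t :=
  fun a b c d h₁ h₂ h₃ h₄ h₅ => by
    have := h a b c d h₁ h₂ h₃ h₄ h₅
    dsimp only
    omega

theorem Avoids.mono {v : ℕ → ℤ} {s t s' t' : ℕ} (h : Avoids v s t) (hs : s ≤ s') (ht : t' ≤ t) :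
    Avoids v s' t' :=
  fun a b c d h₁ h₂ h₃ h₄ h₅ => h a b c d (by omega) h₂ h₃ h₄ (by omega)

/-- A cut of `[s, t)` yields a cut of `[s, t + 1)`, if all initial parts of `[s, t)` have one. -/
theorem exists_cut_of_cut {v : ℕ → ℤ} {s t : ℕ}
    (hinj : ∀ x y, s ≤ x → x < y → y < t + 1 → v x ≠ v y) (hav : Avoids v s (t + 1))
    (ih : ∀ t' ≤ t, s + 1 < t' →
      ∃ m, s < m ∧ m < t' ∧ (Cut v s m t' ∨ Cut (fun x => -v x) s m t'))
    (h : ∃ m, s < m ∧ m < t ∧ Cut v s m t) :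
    ∃ m, s < m ∧ m < t + 1 ∧ (Cut v s m (t + 1) ∨ Cut (fun x => -v x) s m (t + 1)) := by
  classical
  -- Let `m` be the least cut. If `v t` exceeds all values on `[s, m)`, then `m` remains a cut; if
  -- `v t` is below everything, then `t` is a skew cut. Otherwise `[s, m)` has values on both sides
  -- of `v t` and hence a cut `k` of its own.
  obtain ⟨hsm, hmt, hm⟩ := Nat.find_spec h
  have hmin : ∀ m' < Nat.find h, ¬ (s < m' ∧ m' < t ∧ Cut v s m' t) :=
    fun m' => Nat.find_min h
  generalize Nat.find h = m at *
  by_cases h₁ : ∀ x, s ≤ x → x < m → v x < v t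
  · refine ⟨m, hsm, by omega, Or.inl fun x y hx hx' hy hy' => ?_⟩
    rcases Nat.lt_succ_iff_lt_or_eq.1 hy' with hy' | rfl
    · exact hm x y hx hx' hy hy'
    · exact h₁ x hx hx'
  by_cases h₂ : ∀ x, s ≤ x → x < t → v t < v x
  · refine ⟨t, by omega, by omega, Or.inr fun x y hx hx' hy hy' => ?_⟩
    obtain rfl : y = t := by omega
    exact neg_lt_neg (h₂ x hx hx')
  push Not at h₁ h₂
  obtain ⟨p, hsp, hpm, hp⟩ := h₁
  obtain ⟨r, hsr, hrt, hr⟩ := h₂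
  have hp' := hinj p t hsp (by omega) (by omega)
  have hr' := hinj r t hsr hrt (by omega)
  have hrm : r < m := by
    by_contra hrm
    have := hm p r hsp hpm (by omega) hrt
    omega
  obtain ⟨k, hsk, hkm, hk | hk⟩ := ih m hmt.le (by
    by_contra hs
    obtain rfl : p = r := by omega
    omega)
  -- A direct cut of `[s, m)` would also cut `[s, t)`, against the minimality of `m`.
  · refine absurd ⟨hsk, by omega, fun x y hx hx' hy hy' => ?_⟩ (hmin k hkm)
    by_cases hym : y < m
    · exact hk x y hx hx' hy hym
    · exact hm x y hx (by omega) (by omega) hy'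
  · exfalso
    -- As `k` is a skew cut, there is some `a` before `k` with value above `v t` and some `b` from
    -- `k` on with value below it. Then `a`, `b`, `m`, `t` carry the pattern 3142.
    have hA : ∃ a, s ≤ a ∧ a < k ∧ v t < v a := by
      by_contra! hA
      have h₃ : k ≤ p := by
        by_contra hpk
        have := hA p hsp (by omega)
        omega
      have h₄ := hk s p le_rfl hsk h₃ hpm
      have h₅ := hA s le_rfl hsk
      dsimp only at h₄
      omega
    have hB : ∃ b, k ≤ b ∧ b < m ∧ v b < v t := by
      by_contra! hB
      have h₃ : r < k := by
        by_contra hrk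
        have := hB r (by omega) hrm
        omega
      have h₄ := hk r k hsr h₃ le_rfl hkm
      have h₅ := hB k le_rfl hkm
      dsimp only at h₄
      omega
    obtain ⟨a, hsa, hak, ha⟩ := hA
    obtain ⟨b, hkb, hbm, hb⟩ := hB
    have := hm a m hsa (by omega) le_rfl hmt
    exact (hav a b m t hsa (by omega) hbm hmt (by omega)).2 ⟨hb, ha, this⟩

/-- Strong induction on the right end, adding the last point to a shorter interval that already has
a cut. A skew cut is turned into a direct one by negating the values. -/
theorem exists_cut {v : ℕ → ℤ} {s : ℕ} : ∀ {t : ℕ}, s + 1 < t →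
    (∀ x y, s ≤ x → x < y → y < t → v x ≠ v y) → Avoids v s t →
    ∃ m, s < m ∧ m < t ∧ (Cut v s m t ∨ Cut (fun x => -v x) s m t) := by
  intro t
  induction t using Nat.strong_induction_on with
  | _ t ih =>
    intro hst hinj hav
    obtain _ | t := t
    · omega
    have ih' : ∀ t' ≤ t, s + 1 < t' →
        ∃ m, s < m ∧ m < t' ∧ (Cut v s m t' ∨ Cut (fun x => -v x) s m t') :=
      fun t' ht' hs => ih t' (by omega) hs (fun x y hx hxy hy => hinj x y hx hxy (by omega))
        (hav.mono le_rfl (by omega))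
    by_cases ht : t = s + 1
    · subst ht
      refine ⟨s + 1, by omega, by omega, ?_⟩
      have := hinj s (s + 1) le_rfl (by omega) (by omega)
      rcases lt_or_gt_of_ne this with h | h
      · left
        intro x y hx hx' hy hy'
        obtain rfl : x = s := by omega
        obtain rfl : y = x + 1 := by omega
        exact h
      · right
        intro x y hx hx' hy hy'
        obtain rfl : x = s := by omega
        obtain rfl : y = x + 1 := by omega
        exact neg_lt_neg h
    · obtain ⟨m, hm, hmt, h | h⟩ := ih' t le_rfl (by omega)
      · exact exists_cut_of_cut hinj hav ih' ⟨m, hm, hmt, h⟩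
      · obtain ⟨m, hm, hmt, h⟩ := exists_cut_of_cut (v := fun x => -v x)
          (fun x y hx hxy hy => by simpa using hinj x y hx hxy hy) hav.neg
          (fun t' ht' hs => by simpa only [neg_neg, or_comm] using ih' t' ht' hs) ⟨m, hm, hmt, h⟩
        exact ⟨m, hm, hmt, by simpa only [neg_neg, or_comm] using h⟩

/-- Neither 2413 nor 3142 has a proper initial part whose values are all smaller than the remaining
ones, so no occurrence can straddle the cut. -/
theorem Avoids.of_cut {v : ℕ → ℤ} {s m t : ℕ} (h₁ : Avoids v s m) (h₂ : Avoids v m t)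
    (h : Cut v s m t) : Avoids v s t := by
  intro a b c d hsa hab hbc hcd hdt
  by_cases hd : d < m
  · exact h₁ a b c d hsa hab hbc hcd hd
  by_cases ha : m ≤ a
  · exact h₂ a b c d ha hab hbc hcd hdt
  have h₁₂ := h a b hsa (by omega)
  have h₁₃ := h a c hsa (by omega)
  have h₁₄ := h a d hsa (by omega)
  have h₂₃ := h b c (by omega)
  have h₂₄ := h b d (by omega)
  have h₃₄ := h c d (by omega)
  omega

/-! ### Words of patterns -/

/-- The letter of `w` at position `l`. -/
def nth (w : List ℕ) (l : ℕ) : ℕ := w.getD l 0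

/-- Add `n` to all letters. -/
def shift (n : ℕ) (w : List ℕ) : List ℕ := w.map (· + n)

@[simp] theorem length_shift (n : ℕ) (w : List ℕ) : (shift n w).length = w.length := by simp [shift]

theorem nth_append_left {w : List ℕ} (w' : List ℕ) {l : ℕ} (h : l < w.length) :
    nth (w ++ w') l = nth w l := by
  simp [nth, List.getElem?_append_left h, h]

theorem nth_append_right (w w' : List ℕ) (l : ℕ) : nth (w ++ w') (w.length + l) = nth w' l := by
  simp [nth, List.getElem?_append_right]

theorem nth_shift {n : ℕ} {w : List ℕ} {l : ℕ} (h : l < w.length) :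
    nth (shift n w) l = nth w l + n := by
  simp [nth, shift, h]

/-- `w` is the word of a separable permutation with values `0, …, w.length - 1`. -/
structure SepWord (w : List ℕ) : Prop where
  lt : ∀ l < w.length, nth w l < w.length
  inj : ∀ l m, l < m → m < w.length → nth w l ≠ nth w m
  avoids : Avoids (fun l => nth w l) 0 w.length

/-- The direct or skew sum of two separable words. -/
theorem SepWord.sum {w w' : List ℕ} (h : SepWord w) (h' : SepWord w') {k k' : ℕ}
    (hk : k = 0 ∧ k' = w.length ∨ k = w'.length ∧ k' = 0) : SepWord (shift k w ++ shift k' w') := by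
  have hl : ∀ l < w.length, nth (shift k w ++ shift k' w') l = nth w l + k := fun l hl => by
    rw [nth_append_left _ (by simpa using hl), nth_shift hl]
  have hr : ∀ l < w'.length, nth (shift k w ++ shift k' w') (w.length + l) = nth w' l + k' :=
    fun l hl => by
      have := nth_append_right (shift k w) (shift k' w') l
      rw [length_shift] at this
      rw [this, nth_shift hl]
  have hr' : ∀ l, w.length ≤ l → l < w.length + w'.length →
      nth (shift k w ++ shift k' w') l = nth w' (l - w.length) + k' := fun l h₁ h₂ => by
    have := hr (l - w.length) (by omega)
    rwa [Nat.add_sub_cancel' h₁] at this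
  generalize hu : shift k w ++ shift k' w' = u at *
  have hlen : u.length = w.length + w'.length := by simp [← hu]
  have hav₁ : Avoids (fun l => nth u l) 0 w.length := fun a b c d h₁ h₂ h₃ h₄ h₅ => by
    have := h.avoids a b c d h₁ h₂ h₃ h₄ h₅
    dsimp only at this ⊢
    rw [hl a (by omega), hl b (by omega), hl c (by omega), hl d h₅]
    push_cast
    omega
  have hav₂ : Avoids (fun l => nth u l) w.length (w.length + w'.length) :=
    fun a b c d h₁ h₂ h₃ h₄ h₅ => by
      have := h'.avoids (a - w.length) (b - w.length) (c - w.length) (d - w.length)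
        (by omega) (by omega) (by omega) (by omega) (by omega)
      dsimp only at this ⊢
      rw [hr' a (by omega) (by omega), hr' b (by omega) (by omega), hr' c (by omega) (by omega),
        hr' d (by omega) (by omega)]
      push_cast
      omega
  have hcross : ∀ x y, x < w.length → w.length ≤ y → y < w.length + w'.length →
      (k = 0 ∧ nth u x < nth u y) ∨ (k' = 0 ∧ nth u y < nth u x) := by
    intro x y hx hy hy'
    rw [hl x hx, hr' y hy hy']
    have h₁ := h.lt x hx
    have h₂ := h'.lt (y - w.length) (by omega)
    omega
  refine ⟨fun l hl' => ?_, fun l m hlm hm => ?_, ?_⟩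
  · by_cases hlw : l < w.length
    · have := h.lt l hlw
      rw [hl l hlw]; omega
    · have := h'.lt (l - w.length) (by omega)
      rw [hr' l (by omega) (by omega)]; omega
  · by_cases hmw : m < w.length
    · have := h.inj l m hlm hmw
      rw [hl l (by omega), hl m hmw]; omega
    · by_cases hlw : l < w.length
      · have := hcross l m hlw (by omega) (by omega)
        omega
      · have := h'.inj (l - w.length) (m - w.length) (by omega) (by omega)
        rw [hr' l (by omega) (by omega), hr' m (by omega) (by omega)]; omega
  · rw [hlen]
    rcases hk with hk | hk
    · refine hav₁.of_cut hav₂ fun x y _ hx hy hy' => ?_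
      have h₁ := h.lt x hx
      dsimp only
      rw [hl x hx, hr' y hy hy']
      push_cast; omega
    -- A skew sum becomes a direct one when the values are negated.
    · have := hav₁.neg.of_cut hav₂.neg fun x y _ hx hy hy' => by
        have h₁ := h'.lt (y - w.length) (by omega)
        dsimp only
        rw [hl x hx, hr' y hy hy']
        push_cast; omega
      simpa only [neg_neg] using this.neg

/-- The positions `i 0 < i 1 < ⋯` carry an occurrence of `w` in `p`, with positions in `[a, b]`
and values in `[c, d]`. -/
structure Occurs (w p : List ℕ) (i : ℕ → ℕ) (a b c d : ℕ) : Prop where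
  -- For an empty `w` the other fields would not imply these two inequalities.
  le_pos : a ≤ b
  le_val : c ≤ d
  pos : ∀ l < w.length, a ≤ i l ∧ i l ≤ b ∧ i l < p.length
  val : ∀ l < w.length, c ≤ nth p (i l) ∧ nth p (i l) ≤ d
  strictMono : ∀ l m, l < m → m < w.length → i l < i m
  order : ∀ l m, l < w.length → m < w.length → nth w l < nth w m → nth p (i l) < nth p (i m)

/-- The second box lies to the right of the first, and above it for the direct sum or below it for
the skew sum. For letters from different summands, either the boxes force the required order, or the
assumed order of the letters contradicts `hw` or `hw'`. -/
theorem Occurs.sum {w w' p : List ℕ} {i i' : ℕ → ℕ} {a b c d a' b' c' d' : ℕ}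
    (h : Occurs w p i a b c d) (h' : Occurs w' p i' a' b' c' d') (hb : b < a') {k k' : ℕ}
    {c₁ d₁ : ℕ} (hw : ∀ l < w.length, nth w l < w.length)
    (hw' : ∀ l < w'.length, nth w' l < w'.length)
    (hk : (k = 0 ∧ k' = w.length ∧ d < c' ∧ c₁ = c ∧ d₁ = d') ∨
      (k = w'.length ∧ k' = 0 ∧ d' < c ∧ c₁ = c' ∧ d₁ = d)) :
    Occurs (shift k w ++ shift k' w') p
      (fun l => if l < w.length then i l else i' (l - w.length)) a b' c₁ d₁ := by
  have hl : ∀ l < w.length, nth (shift k w ++ shift k' w') l = nth w l + k := fun l hl => by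
    rw [nth_append_left _ (by simpa using hl), nth_shift hl]
  have hr' : ∀ l, w.length ≤ l → l < w.length + w'.length →
      nth (shift k w ++ shift k' w') l = nth w' (l - w.length) + k' := fun l h₁ h₂ => by
    have := nth_append_right (shift k w) (shift k' w') (l - w.length)
    rw [length_shift, Nat.add_sub_cancel' h₁] at this
    rw [this, nth_shift (by omega)]
  generalize hu : shift k w ++ shift k' w' = u at *
  have hlen : u.length = w.length + w'.length := by simp [← hu]
  have h₁ := h.le_pos
  have h₂ := h.le_val
  have h₃ := h'.le_pos
  have h₄ := h'.le_val
  refine ⟨by omega, by omega, fun l hlu => ?_, fun l hlu => ?_, fun l m hlm hm => ?_,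
    fun l m hlu hmu hlm => ?_⟩
  · by_cases hlw : l < w.length
    · have := h.pos l hlw
      simp only [hlw, if_true]; omega
    · have := h'.pos (l - w.length) (by omega)
      simp only [hlw, if_false]; omega
  · by_cases hlw : l < w.length
    · have := h.val l hlw
      simp only [hlw, if_true]; omega
    · have := h'.val (l - w.length) (by omega)
      simp only [hlw, if_false]; omega
  · by_cases hmw : m < w.length
    · have := h.strictMono l m hlm hmw
      simpa only [hmw, hlm.trans hmw, if_true] using this
    · have h₅ := h'.pos (m - w.length) (by omega)
      by_cases hlw : l < w.length
      · have := h.pos l hlw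
        simp only [hlw, hmw, if_true, if_false]; omega
      · have := h'.strictMono (l - w.length) (m - w.length) (by omega) (by omega)
        simpa only [hlw, hmw, if_false] using this
  · by_cases hlw : l < w.length <;> by_cases hmw : m < w.length <;>
      simp only [hlw, hmw, if_true, if_false]
    · rw [hl l hlw, hl m hmw] at hlm
      exact h.order l m hlw hmw (by omega)
    · have h₅ := h.val l hlw
      have h₆ := h'.val (m - w.length) (by omega)
      have h₇ := hw' (m - w.length) (by omega)
      rw [hl l hlw, hr' m (by omega) (by omega)] at hlm
      omega
    · have h₅ := h.val m hmw
      have h₆ := h'.val (l - w.length) (by omega)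
      have h₇ := hw m hmw
      rw [hl m hmw, hr' l (by omega) (by omega)] at hlm
      omega
    · rw [hr' l (by omega) (by omega), hr' m (by omega) (by omega)] at hlm
      exact h'.order _ _ (by omega) (by omega) (by omega)

theorem Occurs.length_le {w p : List ℕ} {i : ℕ → ℕ} {a b c d : ℕ} (h : Occurs w p i a b c d) :
    w.length ≤ p.length := by
  have : ∀ n ≤ w.length, n ≤ p.length ∧ ∀ l < n, l ≤ i l := by
    intro n
    induction n with
    | zero => simp
    | succ n ih =>
      intro hn
      obtain ⟨ih₁, ih₂⟩ := ih (by omega)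
      have h₁ := h.pos n (by omega)
      have h₂ : n ≤ i n := by
        rcases Nat.eq_zero_or_pos n with rfl | hn'
        · omega
        · have := ih₂ (n - 1) (by omega)
          have := h.strictMono (n - 1) n (by omega) (by omega)
          omega
      refine ⟨by omega, fun l hl => ?_⟩
      rcases Nat.lt_succ_iff_lt_or_eq.1 hl with hl | rfl
      · exact ih₂ l hl
      · exact h₂
  exact (this _ le_rfl).1

/-! ### The table of common patterns -/

/-- The least positions, greatest positions, least values and greatest values of occurrences of a
pattern in several words, and the word of the pattern. -/
abbrev Entry : Type := ((List ℕ × List ℕ) × (List ℕ × List ℕ)) × List ℕ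

/-- Componentwise `<`. -/
def allLt (l r : List ℕ) : Bool := (l.zip r).all fun p => decide (p.1 < p.2)

/-- Componentwise equality. -/
def allEq (l r : List ℕ) : Bool := (l.zip r).all fun p => !decide (p.1 < p.2) && !decide (p.2 < p.1)

theorem allLt_ofFn {K : ℕ} (a b : Fin K → ℕ) :
    allLt (List.ofFn a) (List.ofFn b) = true ↔ ∀ q, a q < b q := by
  unfold allLt
  induction K with
  | zero => simp
  | succ K ih => simp [List.ofFn_succ, ih, Fin.forall_fin_succ]

/-- `zip` truncates, so the comparison is reliable only for lists of equal length; signatures of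
sound entries have this property. -/
theorem allEq_iff : ∀ {l r : List ℕ}, l.length = r.length → (allEq l r = true ↔ l = r)
  | [], [], _ => by simp [allEq]
  | x :: l, y :: r, h => by
    have ih := allEq_iff (l := l) (r := r) (by simpa using h)
    unfold allEq at ih ⊢
    rw [List.zip_cons_cons, List.all_cons, Bool.and_eq_true, ih]
    simp
    intro _
    omega

/-- The bounds and the length of an entry. -/
def sig (e : Entry) : List ℕ := e.2.length :: (e.1.1.1 ++ (e.1.1.2 ++ (e.1.2.1 ++ e.1.2.2)))

/-- Add an entry, unless there is one with the same bounds and the same length. -/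
def insertEntry (T : List Entry) (e : Entry) : List Entry :=
  if T.any fun e' => allEq (sig e) (sig e') then T else e :: T

/-- The direct and skew sums of two entries that the bounds admit. -/
def sums (e e' : Entry) : List Entry :=
  if allLt e.1.1.2 e'.1.1.1 then
    (if allLt e.1.2.2 e'.1.2.1 then
      [(((e.1.1.1, e'.1.1.2), (e.1.2.1, e'.1.2.2)), shift 0 e.2 ++ shift e.2.length e'.2)]
      else []) ++
    (if allLt e'.1.2.2 e.1.2.1 then
      [(((e.1.1.1, e'.1.1.2), (e'.1.2.1, e.1.2.2)), shift e'.2.length e.2 ++ shift 0 e'.2)]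
      else [])
  else []

/-- Add the sums of all pairs of entries. -/
def round (T : List Entry) : List Entry :=
  (T.flatMap fun e => T.flatMap fun e' => sums e e').foldl insertEntry T

/-- The choices of one position in each of the words, with the values there. -/
def points (ps : List (List ℕ)) : List (List ℕ × List ℕ) :=
  ps.foldr (fun p acc => ((List.range p.length).zip p).flatMap fun x =>
    acc.map fun y => (x.1 :: y.1, x.2 :: y.2)) [([], [])]

/-- The entries of the pattern of length one. -/
def startTable (ps : List (List ℕ)) : List Entry :=
  ((points ps).map fun x => (((x.1, x.1), (x.2, x.2)), [0])).foldl insertEntry []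

/-- The longest word of a table. -/
def longest (T : List Entry) : List ℕ :=
  T.foldl (fun w e => if decide (w.length < e.2.length) then e.2 else w) []

theorem mem_points {K : ℕ} (P : Fin K → List ℕ) (x : List ℕ × List ℕ) :
    x ∈ points (List.ofFn P) ↔ ∃ i : Fin K → ℕ, (∀ q, i q < (P q).length) ∧
      x = (List.ofFn i, List.ofFn fun q => nth (P q) (i q)) := by
  have hzip : ∀ (p : List ℕ) (y : ℕ × ℕ), y ∈ (List.range p.length).zip p ↔
      ∃ i < p.length, y = (i, nth p i) := by
    intro p y
    constructor
    · intro h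
      obtain ⟨i, hi, rfl⟩ := List.getElem_of_mem h
      simp only [List.length_zip, List.length_range, min_self] at hi
      exact ⟨i, hi, by simp [nth, hi]⟩
    · rintro ⟨i, hi, rfl⟩
      refine List.mem_iff_getElem.2 ⟨i, by simpa using hi, by simp [nth, hi]⟩
  induction K generalizing x with
  | zero =>
    simp only [points, List.ofFn_zero, List.foldr_nil, List.mem_singleton]
    exact ⟨fun h => ⟨Fin.elim0, fun q => q.elim0, h⟩, fun ⟨_, _, h⟩ => h⟩
  | succ K ih =>
    have e : points (List.ofFn P) = ((List.range (P 0).length).zip (P 0)).flatMap fun x =>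
        (points (List.ofFn fun q => P (Fin.succ q))).map
          fun y => (x.1 :: y.1, x.2 :: y.2) := by
      rw [List.ofFn_succ]; rfl
    rw [e]
    simp only [List.mem_flatMap, List.mem_map, hzip, ih]
    constructor
    · rintro ⟨_, ⟨i, hi, rfl⟩, _, ⟨j, hj, rfl⟩, rfl⟩
      refine ⟨Fin.cons i j, fun q => ?_, ?_⟩
      · refine Fin.cases ?_ (fun q => ?_) q
        · simpa using hi
        · simpa using hj q
      · simp [List.ofFn_succ]
    · rintro ⟨i, hi, rfl⟩
      refine ⟨_, ⟨i 0, hi 0, rfl⟩, _, ⟨fun q => i q.succ, fun q => hi q.succ, rfl⟩, ?_⟩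
      simp [List.ofFn_succ]

/-! ### Soundness of the table and absence of duplicates. -/

/-- `e` has the given bounds. -/
def HasKey {K : ℕ} (e : Entry) (a b c d : Fin K → ℕ) : Prop :=
  e.1 = ((List.ofFn a, List.ofFn b), (List.ofFn c, List.ofFn d))

/-- `e` describes a separable pattern that occurs in all words `P q` within its bounds. -/
def Sound {K : ℕ} (P : Fin K → List ℕ) (N : ℕ) (e : Entry) : Prop :=
  ∃ a b c d : Fin K → ℕ, HasKey e a b c d ∧ (∀ q, b q ≤ N ∧ d q ≤ N) ∧ SepWord e.2 ∧
    ∀ q, ∃ i, Occurs e.2 (P q) i (a q) (b q) (c q) (d q)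

theorem sepWord_singleton : SepWord [0] :=
  ⟨by simp [nth], by simp; omega, fun a b c d _ _ _ _ hd => by simp at hd; omega⟩

theorem subset_foldl_insertEntry (C : List Entry) :
    ∀ T : List Entry, T ⊆ C.foldl insertEntry T := by
  induction C with
  | nil => exact fun T => List.Subset.refl T
  | cons e C ih =>
    intro T
    refine List.Subset.trans ?_ (ih (insertEntry T e))
    unfold insertEntry
    split
    · exact List.Subset.refl T
    · exact List.subset_cons_self e T

theorem mem_foldl_insertEntry {C : List Entry} : ∀ {T : List Entry} {e : Entry},
    e ∈ C.foldl insertEntry T → e ∈ T ∨ e ∈ C := by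
  induction C with
  | nil => exact fun h => Or.inl h
  | cons e' C ih =>
    intro T e h
    rcases ih h with h | h
    · unfold insertEntry at h
      split at h
      · exact Or.inl h
      · rcases List.mem_cons.1 h with rfl | h
        · exact Or.inr List.mem_cons_self
        · exact Or.inl h
    · exact Or.inr (List.mem_cons_of_mem _ h)

variable {K : ℕ} {P : Fin K → List ℕ} {N : ℕ}

theorem Sound.length_sig {e : Entry} (h : Sound P N e) : (sig e).length = 4 * K + 1 := by
  obtain ⟨a, b, c, d, hk, -⟩ := h
  rw [HasKey] at hk
  simp [sig, hk]; ring

/-- All four blocks of bounds have length `K`, so nothing is lost by concatenating them. -/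
theorem Sound.eq_of_sig_eq {e e' : Entry} (h : Sound P N e) (h' : Sound P N e')
    (hs : sig e = sig e') : e'.1 = e.1 ∧ e'.2.length = e.2.length := by
  obtain ⟨a, b, c, d, hk, -⟩ := h
  obtain ⟨a', b', c', d', hk', -⟩ := h'
  rw [HasKey] at hk hk'
  simp only [sig, hk, hk', List.cons.injEq] at hs
  obtain ⟨h₀, hs⟩ := hs
  obtain ⟨h₁, hs⟩ := List.append_inj hs (by simp)
  obtain ⟨h₂, hs⟩ := List.append_inj hs (by simp)
  obtain ⟨h₃, hs⟩ := List.append_inj hs (by simp)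
  exact ⟨by rw [hk, hk', h₁, h₂, h₃, hs], h₀.symm⟩

/-- An entry may be dropped in favour of another word, but its bounds and its length survive, and
later sums depend on nothing else for their bounds and lengths. -/
theorem exists_mem_insertEntry {T : List Entry} {e : Entry} (hT : ∀ e ∈ T, Sound P N e)
    (he : Sound P N e) : ∃ e' ∈ insertEntry T e, e'.1 = e.1 ∧ e'.2.length = e.2.length := by
  unfold insertEntry
  split
  · next h =>
    obtain ⟨e', he', h⟩ := List.any_eq_true.1 h
    rw [allEq_iff (by rw [he.length_sig, (hT e' he').length_sig])] at h
    exact ⟨e', he', he.eq_of_sig_eq (hT e' he') h⟩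
  · exact ⟨e, List.mem_cons_self, rfl, rfl⟩

theorem sound_insertEntry {T : List Entry} {e : Entry} (hT : ∀ e ∈ T, Sound P N e)
    (he : Sound P N e) : ∀ e' ∈ insertEntry T e, Sound P N e' := by
  intro e' h
  unfold insertEntry at h
  split at h
  · exact hT e' h
  · rcases List.mem_cons.1 h with rfl | h
    · exact he
    · exact hT e' h

theorem exists_mem_foldl_insertEntry {C : List Entry} : ∀ {T : List Entry} {e : Entry},
    (∀ e ∈ T, Sound P N e) → (∀ e ∈ C, Sound P N e) → e ∈ C →
    ∃ e' ∈ C.foldl insertEntry T, e'.1 = e.1 ∧ e'.2.length = e.2.length := by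
  induction C with
  | nil => intro T e _ _ h; simp at h
  | cons e₁ C ih =>
    intro T e hT hC he
    rcases List.mem_cons.1 he with rfl | he
    · obtain ⟨e', he', h⟩ := exists_mem_insertEntry hT (hC e List.mem_cons_self)
      exact ⟨e', subset_foldl_insertEntry C _ he', h⟩
    · exact ih (sound_insertEntry hT (hC e₁ List.mem_cons_self))
        (fun e h => hC e (List.mem_cons_of_mem _ h)) he

theorem nodup_sig_foldl_insertEntry {C : List Entry} : ∀ {T : List Entry},
    (∀ e ∈ T, Sound P N e) → (∀ e ∈ C, Sound P N e) → (T.map sig).Nodup →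
    ((C.foldl insertEntry T).map sig).Nodup := by
  induction C with
  | nil => exact fun _ _ h => h
  | cons e C ih =>
    intro T hT hC h
    have he := hC e List.mem_cons_self
    refine ih (sound_insertEntry hT he) (fun e h => hC e (List.mem_cons_of_mem _ h)) ?_
    unfold insertEntry
    split
    · exact h
    · next h' =>
      rw [List.map_cons, List.nodup_cons]
      refine ⟨fun hm => h' ?_, h⟩
      obtain ⟨e', he', hs⟩ := List.mem_map.1 hm
      refine List.any_eq_true.2 ⟨e', he', ?_⟩
      rw [allEq_iff (by rw [hs]), hs]

theorem Sound.sums {e e' : Entry} (h : Sound P N e) (h' : Sound P N e') :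
    ∀ e₁ ∈ sums e e', Sound P N e₁ := by
  obtain ⟨a, b, c, d, hk, hN, hw, hi⟩ := h
  obtain ⟨a', b', c', d', hk', hN', hw', hi'⟩ := h'
  intro e₁ he
  rw [HasKey] at hk hk'
  simp only [LCSep.sums, hk, hk', allLt_ofFn] at he
  choose i hi using hi
  choose i' hi' using hi'
  split at he
  · next hb =>
    rcases List.mem_append.1 he with he | he <;> split at he
    · next hd =>
      obtain rfl := List.mem_singleton.1 he
      refine ⟨a, b', c, d', rfl, fun q => ⟨(hN' q).1, (hN' q).2⟩,
        hw.sum hw' (Or.inl ⟨rfl, rfl⟩), fun q => ⟨_, (hi q).sum (hi' q) (hb q) hw.lt hw'.lt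
          (Or.inl ⟨rfl, rfl, hd q, rfl, rfl⟩)⟩⟩
    · simp at he
    · next hd =>
      obtain rfl := List.mem_singleton.1 he
      refine ⟨a, b', c', d, rfl, fun q => ⟨(hN' q).1, (hN q).2⟩,
        hw.sum hw' (Or.inr ⟨rfl, rfl⟩), fun q => ⟨_, (hi q).sum (hi' q) (hb q) hw.lt hw'.lt
          (Or.inr ⟨rfl, rfl, hd q, rfl, rfl⟩)⟩⟩
    · simp at he
  · simp at he

/-- All entries are sound, and different entries have different signatures. -/
structure GoodTable (P : Fin K → List ℕ) (N : ℕ) (T : List Entry) : Prop where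
  sound : ∀ e ∈ T, Sound P N e
  nodup : (T.map sig).Nodup

theorem GoodTable.foldl_insertEntry {T C : List Entry} (hT : GoodTable P N T)
    (hC : ∀ e ∈ C, Sound P N e) : GoodTable P N (C.foldl insertEntry T) :=
  ⟨fun e he => (mem_foldl_insertEntry he).elim (hT.sound e) (hC e),
    nodup_sig_foldl_insertEntry hT.sound hC hT.nodup⟩

theorem GoodTable.sound_sums {T : List Entry} (hT : GoodTable P N T) :
    ∀ e ∈ T.flatMap fun e => T.flatMap fun e' => sums e e', Sound P N e := by
  intro e he
  simp only [List.mem_flatMap] at he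
  obtain ⟨e₁, he₁, e₂, he₂, he⟩ := he
  exact (hT.sound e₁ he₁).sums (hT.sound e₂ he₂) e he

theorem GoodTable.round {T : List Entry} (hT : GoodTable P N T) : GoodTable P N (round T) :=
  hT.foldl_insertEntry hT.sound_sums

theorem GoodTable.exists_mem_round {T : List Entry} (hT : GoodTable P N T) {e e₁ e₂ : Entry}
    (h₁ : e₁ ∈ T) (h₂ : e₂ ∈ T) (he : e ∈ sums e₁ e₂) :
    ∃ e' ∈ LCSep.round T, e'.1 = e.1 ∧ e'.2.length = e.2.length :=
  exists_mem_foldl_insertEntry hT.sound hT.sound_sums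
    (List.mem_flatMap.2 ⟨e₁, h₁, List.mem_flatMap.2 ⟨e₂, h₂, he⟩⟩)

theorem sound_start (hN : ∀ q, (P q).length ≤ N) (hP : ∀ q l, l < (P q).length → nth (P q) l ≤ N) :
    ∀ e ∈ (points (List.ofFn P)).map
      fun x => ((((x.1, x.1), (x.2, x.2)), [0]) : Entry), Sound P N e := by
  intro e he
  obtain ⟨x, hx, rfl⟩ := List.mem_map.1 he
  obtain ⟨i, hi, rfl⟩ := (mem_points P x).1 hx
  refine ⟨i, i, fun q => nth (P q) (i q), fun q => nth (P q) (i q), rfl,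
    fun q => ⟨(hi q).le.trans (hN q), hP q _ (hi q)⟩, sepWord_singleton,
    fun q => ⟨fun _ => i q, le_rfl, le_rfl, fun l _ => ⟨le_rfl, le_rfl, hi q⟩,
      fun l _ => ⟨le_rfl, le_rfl⟩, ?_, ?_⟩⟩
  · intro l m h₁ h₂; simp at h₂; omega
  · intro l m h₁ h₂ h₃
    simp only [List.length_singleton, Nat.lt_one_iff] at h₁ h₂
    subst h₁ h₂
    omega

theorem goodTable_start (hN : ∀ q, (P q).length ≤ N)
    (hP : ∀ q l, l < (P q).length → nth (P q) l ≤ N) :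
    GoodTable P N (startTable (List.ofFn P)) :=
  GoodTable.foldl_insertEntry ⟨by simp, by simp⟩ (sound_start hN hP)

theorem goodTable_iterate (hN : ∀ q, (P q).length ≤ N)
    (hP : ∀ q l, l < (P q).length → nth (P q) l ≤ N) (r : ℕ) :
    GoodTable P N (round^[r] (startTable (List.ofFn P))) := by
  induction r with
  | zero => exact goodTable_start hN hP
  | succ r ih => rw [Function.iterate_succ_apply']; exact ih.round

/-! ### Completeness of the table. -/

/-- A sequence of values and its occurrences in all words. -/
structure CommonOcc (P : Fin K → List ℕ) (n : ℕ) (v : ℕ → ℤ) (i : Fin K → ℕ → ℕ) : Prop where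
  inj : ∀ l m, l < m → m < n → v l ≠ v m
  avoids : Avoids v 0 n
  pos : ∀ q, ∀ l < n, i q l < (P q).length
  strictMono : ∀ q l m, l < m → m < n → i q l < i q m
  order : ∀ q l m, l < n → m < n → v l < v m → nth (P q) (i q l) < nth (P q) (i q m)

theorem exists_argmin (v : ℕ → ℤ) {s t : ℕ} (h : s < t) :
    ∃ l, s ≤ l ∧ l < t ∧ ∀ x, s ≤ x → x < t → v l ≤ v x := by
  obtain ⟨l, hl, hm⟩ := (Finset.Ico s t).exists_min_image v ⟨s, by simpa using h⟩
  rw [Finset.mem_Ico] at hl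
  exact ⟨l, hl.1, hl.2, fun x h₁ h₂ => hm x (Finset.mem_Ico.2 ⟨h₁, h₂⟩)⟩

theorem exists_argmax (v : ℕ → ℤ) {s t : ℕ} (h : s < t) :
    ∃ l, s ≤ l ∧ l < t ∧ ∀ x, s ≤ x → x < t → v x ≤ v l := by
  obtain ⟨l, h₁, h₂, h₃⟩ := exists_argmin (fun x => -v x) h
  exact ⟨l, h₁, h₂, fun x hx hx' => neg_le_neg_iff.1 (h₃ x hx hx')⟩

/-- After `r` rounds the table knows all parts of length at most `r + 1` of common patterns. -/
theorem CommonOcc.exists_mem {n : ℕ} {v : ℕ → ℤ} {i : Fin K → ℕ → ℕ} (h : CommonOcc P n v i)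
    (hN : ∀ q, (P q).length ≤ N) (hP : ∀ q l, l < (P q).length → nth (P q) l ≤ N) (r : ℕ) :
    ∀ s t l₀ l₁, s < t → t ≤ n → t ≤ s + (r + 1) → s ≤ l₀ → l₀ < t → s ≤ l₁ → l₁ < t →
      (∀ x, s ≤ x → x < t → v l₀ ≤ v x) → (∀ x, s ≤ x → x < t → v x ≤ v l₁) →
      ∃ e ∈ round^[r] (startTable (List.ofFn P)), HasKey e (fun q => i q s) (fun q => i q (t - 1))
        (fun q => nth (P q) (i q l₀)) (fun q => nth (P q) (i q l₁)) ∧ e.2.length = t - s := by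
  induction r with
  | zero =>
    intro s t l₀ l₁ hst htn htr h₁ h₂ h₃ h₄ _ _
    obtain rfl : l₀ = s := by omega
    obtain rfl : l₁ = l₀ := by omega
    obtain rfl : t = l₁ + 1 := by omega
    obtain ⟨e, he, hk, hl⟩ := exists_mem_foldl_insertEntry (T := []) (by simp)
      (sound_start hN hP) (List.mem_map_of_mem (f := fun x : List ℕ × List ℕ =>
        ((((x.1, x.1), (x.2, x.2)), [0]) : Entry)) ((mem_points P _).2
        ⟨fun q => i q l₁, fun q => h.pos q l₁ (by omega), rfl⟩))
    exact ⟨e, he, by rw [HasKey, hk]; rfl, by rw [hl]; simp⟩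
  | succ r ih =>
    intro s t l₀ l₁ hst htn htr h₁ h₂ h₃ h₄ h₅ h₆
    rw [Function.iterate_succ_apply']
    have hgood := goodTable_iterate (P := P) hN hP r
    by_cases ht : t ≤ s + (r + 1)
    · obtain ⟨e, he, hk⟩ := ih s t l₀ l₁ hst htn ht h₁ h₂ h₃ h₄ h₅ h₆
      exact ⟨e, subset_foldl_insertEntry _ _ he, hk⟩
    -- The interval has length `r + 2`, so both sides of the cut have length at most `r + 1` and are
    -- represented with their exact boxes.
    obtain ⟨m, hsm, hmt, hcut⟩ := exists_cut (v := v) (s := s) (t := t) (by omega)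
      (fun x y _ hxy hy => h.inj x y hxy (by omega)) (h.avoids.mono (by omega) htn)
    obtain ⟨x₀, hx₀, hx₀', hx₀m⟩ := exists_argmin v hsm
    obtain ⟨x₁, hx₁, hx₁', hx₁m⟩ := exists_argmax v hsm
    obtain ⟨y₀, hy₀, hy₀', hy₀m⟩ := exists_argmin v hmt
    obtain ⟨y₁, hy₁, hy₁', hy₁m⟩ := exists_argmax v hmt
    obtain ⟨e₁, he₁, hk₁, hn₁⟩ := ih s m x₀ x₁ hsm (by omega) (by omega) hx₀ hx₀' hx₁ hx₁' hx₀m hx₁m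
    obtain ⟨e₂, he₂, hk₂, hn₂⟩ := ih m t y₀ y₁ hmt htn (by omega) hy₀ hy₀' hy₁ hy₁' hy₀m hy₁m
    have hpos : ∀ q, i q (m - 1) < i q m := fun q => h.strictMono q _ _ (by omega) (by omega)
    -- Extremal points are unique, so the given `l₀` and `l₁` can be identified with extremal points
    -- of the two parts.
    have huniq : ∀ x y, x < n → y < n → v x ≤ v y → v y ≤ v x → x = y := by
      intro x y hx hy hxy hyx
      by_contra hne
      rcases Nat.lt_or_gt_of_ne hne with h' | h'
      · exact h.inj x y h' hy (by omega)
      · exact h.inj y x h' hx (by omega)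
    rw [HasKey] at hk₁ hk₂
    rcases hcut with hcut | hcut
    -- At a direct cut the minimum lies on the left and the maximum on the right.
    · obtain rfl : l₀ = x₀ := huniq _ _ (by omega) (by omega) (h₅ x₀ (by omega) (by omega)) (by
        by_cases hl : l₀ < m
        · exact hx₀m l₀ h₁ hl
        · exact (hcut x₀ l₀ hx₀ hx₀' (by omega) h₂).le)
      obtain rfl : l₁ = y₁ := huniq _ _ (by omega) (by omega) (by
        by_cases hl : l₁ < m
        · exact (hcut l₁ y₁ h₃ hl hy₁ hy₁').le
        · exact hy₁m l₁ (by omega) h₄) (h₆ y₁ (by omega) (by omega))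
      have hval : ∀ q, nth (P q) (i q x₁) < nth (P q) (i q y₀) := fun q =>
        h.order q _ _ (by omega) (by omega) (hcut x₁ y₀ hx₁ hx₁' hy₀ hy₀')
      obtain ⟨e, he, hk, hl⟩ := hgood.exists_mem_round he₁ he₂
        (e := (((e₁.1.1.1, e₂.1.1.2), (e₁.1.2.1, e₂.1.2.2)),
          shift 0 e₁.2 ++ shift e₁.2.length e₂.2)) (by
          simp only [LCSep.sums, hk₁, hk₂, allLt_ofFn, hpos, hval, implies_true, if_true]
          simp)
      refine ⟨e, he, ?_, ?_⟩
      · rw [HasKey, hk, hk₁, hk₂]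
      · rw [hl]; simp [hn₁, hn₂]; omega
    -- At a skew cut the two sides change roles.
    · obtain rfl : l₀ = y₀ := huniq _ _ (by omega) (by omega) (h₅ y₀ (by omega) (by omega)) (by
        by_cases hl : l₀ < m
        · exact (neg_lt_neg_iff.1 (hcut l₀ y₀ h₁ hl hy₀ hy₀')).le
        · exact hy₀m l₀ (by omega) h₂)
      obtain rfl : l₁ = x₁ := huniq _ _ (by omega) (by omega) (by
        by_cases hl : l₁ < m
        · exact hx₁m l₁ h₃ hl
        · exact (neg_lt_neg_iff.1 (hcut x₁ l₁ hx₁ hx₁' (by omega) h₄)).le)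
        (h₆ x₁ (by omega) (by omega))
      have hval : ∀ q, nth (P q) (i q y₁) < nth (P q) (i q x₀) := fun q =>
        h.order q _ _ (by omega) (by omega) (neg_lt_neg_iff.1 (hcut x₀ y₁ hx₀ hx₀' hy₁ hy₁'))
      obtain ⟨e, he, hk, hl⟩ := hgood.exists_mem_round he₁ he₂
        (e := (((e₁.1.1.1, e₂.1.1.2), (e₂.1.2.1, e₁.1.2.2)),
          shift e₂.2.length e₁.2 ++ shift 0 e₂.2)) (by
          simp only [LCSep.sums, hk₁, hk₂, allLt_ofFn, hpos, hval, implies_true, if_true]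
          simp)
      refine ⟨e, he, ?_, ?_⟩
      · rw [HasKey, hk, hk₁, hk₂]
      · rw [hl]; simp [hn₁, hn₂]; omega

theorem longest_spec (T : List Entry) :
    (longest T = [] ∨ ∃ e ∈ T, longest T = e.2) ∧ ∀ e ∈ T, e.2.length ≤ (longest T).length := by
  have h : ∀ (T : List Entry) (w : List ℕ),
      (T.foldl (fun w e => if decide (w.length < e.2.length) then e.2 else w) w = w ∨
        ∃ e ∈ T, T.foldl (fun w e => if decide (w.length < e.2.length) then e.2 else w) w = e.2) ∧
      w.length ≤ (T.foldl (fun w e => if decide (w.length < e.2.length) then e.2 else w) w).length ∧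
      ∀ e ∈ T, e.2.length ≤
        (T.foldl (fun w e => if decide (w.length < e.2.length) then e.2 else w) w).length := by
    intro T
    induction T with
    | nil => simp
    | cons e T ih =>
      intro w
      obtain ⟨h₁, h₂, h₃⟩ := ih (if decide (w.length < e.2.length) then e.2 else w)
      rw [List.foldl_cons]
      generalize hW : List.foldl _ _ T = W at h₁ h₂ h₃ ⊢
      have h₄ : e.2.length ≤ W.length ∧ w.length ≤ W.length := by
        split at h₂ <;> simp_all <;> omega
      refine ⟨?_, h₄.2, ?_⟩
      · rcases h₁ with h₁ | ⟨e', he', h₁⟩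
        · split at h₁
          · exact Or.inr ⟨e, List.mem_cons_self, h₁⟩
          · exact Or.inl h₁
        · exact Or.inr ⟨e', List.mem_cons_of_mem _ he', h₁⟩
      · intro e' he'
        rcases List.mem_cons.1 he' with rfl | he'
        · exact h₄.1
        · exact h₃ e' he'
  exact ⟨(h T []).1, (h T []).2.2⟩

/-! ### Permutations and their words -/

/-- The word of a permutation, with values `1, …, n`. -/
def permWord (σ : FinPerm) : List ℕ := List.ofFn fun i => (σ.2 i : ℕ) + 1

@[simp] theorem length_permWord (σ : FinPerm) : (permWord σ).length = σ.length := by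
  simp [permWord]

theorem nth_permWord (σ : FinPerm) (i : Fin σ.length) :
    nth (permWord σ) i = (σ.2 i : ℕ) + 1 := by
  simp [nth, permWord]

theorem nth_permWord_le (σ : FinPerm) (l : ℕ) (h : l < (permWord σ).length) :
    nth (permWord σ) l ≤ σ.length := by
  rw [length_permWord] at h
  exact (nth_permWord σ ⟨l, h⟩).trans_le (σ.2 ⟨l, h⟩).2

theorem le_of_mem_permWord {σ : FinPerm} {x : ℕ} (h : x ∈ permWord σ) : x ≤ σ.length := by
  obtain ⟨i, rfl⟩ := (List.mem_ofFn' _ _).1 h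
  exact (σ.2 i).2

/-- The permutation with a given word. -/
noncomputable def SepWord.toPerm {w : List ℕ} (h : SepWord w) : FinPerm :=
  ⟨w.length, Equiv.ofBijective (fun i => ⟨nth w i, h.lt i i.2⟩)
    (Finite.injective_iff_bijective.1 fun i j hij => by
      by_contra hne
      have hij' : nth w i = nth w j := congrArg Fin.val hij
      rcases lt_or_gt_of_ne hne with hlt | hlt
      · exact h.inj i j hlt j.2 hij'
      · exact h.inj j i hlt i.2 hij'.symm)⟩

theorem SepWord.permWord_toPerm {w : List ℕ} (h : SepWord w) :
    permWord h.toPerm = w.map (· + 1) := by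
  refine List.ext_getElem (by simp [permWord, SepWord.toPerm]) fun l h₁ h₂ => ?_
  have hl : l < w.length := by simpa using h₂
  have : (permWord h.toPerm)[l] = nth w l + 1 := by
    simp only [permWord, List.getElem_ofFn]
    rfl
  rw [this]
  simp [nth, hl]

theorem SepWord.isSeparable_toPerm {w : List ℕ} (h : SepWord w) : IsSeparable h.toPerm := by
  have key : ∀ i : Fin 4 → Fin w.length, StrictMono i →
      ¬ (nth w (i 2) < nth w (i 0) ∧ nth w (i 0) < nth w (i 3) ∧ nth w (i 3) < nth w (i 1)) ∧
      ¬ (nth w (i 1) < nth w (i 3) ∧ nth w (i 3) < nth w (i 0) ∧ nth w (i 0) < nth w (i 2)) := by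
    intro i hi
    have := h.avoids (i 0) (i 1) (i 2) (i 3) (by omega) (hi (by decide)) (hi (by decide))
      (hi (by decide)) (i 3).2
    simpa using this
  constructor
  · rintro ⟨i, hi, ho⟩
    exact (key i hi).1 ⟨ho (2 : Fin 4) (0 : Fin 4) (by decide),
      ho (0 : Fin 4) (3 : Fin 4) (by decide), ho (3 : Fin 4) (1 : Fin 4) (by decide)⟩
  · rintro ⟨i, hi, ho⟩
    exact (key i hi).2 ⟨ho (1 : Fin 4) (3 : Fin 4) (by decide),
      ho (3 : Fin 4) (0 : Fin 4) (by decide), ho (0 : Fin 4) (2 : Fin 4) (by decide)⟩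

theorem Occurs.isPattern {w : List ℕ} (h : SepWord w) {σ : FinPerm} {i : ℕ → ℕ} {a b c d : ℕ}
    (ho : Occurs w (permWord σ) i a b c d) : IsPattern h.toPerm σ := by
  have hi : ∀ l : Fin w.length, i l < σ.length := fun l => by
    simpa using (ho.pos l l.2).2.2
  refine ⟨fun l : Fin w.length => ⟨i l, hi l⟩, fun l m hlm => ho.strictMono l m hlm m.2,
    fun l m hlm => ?_⟩
  have := ho.order l m l.2 m.2 hlm
  rw [nth_permWord σ ⟨i l, hi l⟩, nth_permWord σ ⟨i m, hi m⟩] at this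
  exact Fin.lt_def.2 (Nat.lt_of_add_lt_add_right this)

theorem IsSeparable.avoids {τ : FinPerm} (h : IsSeparable τ) :
    Avoids (fun l => nth (permWord τ) l) 0 τ.length := by
  intro a b c d _ hab hbc hcd hd
  have e : ∀ x (hx : x < τ.length), nth (permWord τ) x = (τ.2 ⟨x, hx⟩ : ℕ) + 1 :=
    fun x hx => nth_permWord τ ⟨x, hx⟩
  have ha' : a < τ.length := by omega
  have hb' : b < τ.length := by omega
  have hc' : c < τ.length := by omega
  dsimp only
  rw [e a ha', e b hb', e c hc', e d hd]
  have hmono : StrictMono (![⟨a, ha'⟩, ⟨b, hb'⟩, ⟨c, hc'⟩, ⟨d, hd⟩] : Fin 4 → Fin τ.length) := by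
    refine Fin.strictMono_iff_lt_succ.2 fun x => ?_
    fin_cases x
    · exact hab
    · exact hbc
    · exact hcd
  constructor
  · rintro ⟨h₁, h₂, h₃⟩
    refine h.1 ⟨_, hmono, fun l m hlm => ?_⟩
    fin_cases l <;> fin_cases m <;> first
      | exact absurd hlm (by decide)
      | (simp only [perm2413] at *; refine Fin.lt_def.2 ?_; simp; omega)
  · rintro ⟨h₁, h₂, h₃⟩
    refine h.2 ⟨_, hmono, fun l m hlm => ?_⟩
    fin_cases l <;> fin_cases m <;> first
      | exact absurd hlm (by decide)
      | (simp only [perm3142] at *; refine Fin.lt_def.2 ?_; simp; omega)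

theorem exists_commonOcc {K : ℕ} {σ : Fin K → FinPerm} {τ : FinPerm}
    (h : IsCommonSeparablePattern σ τ) :
    ∃ i, CommonOcc (fun q => permWord (σ q)) τ.length (fun l => nth (permWord τ) l) i := by
  choose i hi ho using h.2
  have e : ∀ x (hx : x < τ.length), nth (permWord τ) x = (τ.2 ⟨x, hx⟩ : ℕ) + 1 :=
    fun x hx => nth_permWord τ ⟨x, hx⟩
  -- The default 0 is harmless: all conditions concern indices below `τ.length`.
  refine ⟨fun q l => if hl : l < τ.length then i q ⟨l, hl⟩ else 0, ?_, h.1.avoids, ?_, ?_, ?_⟩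
  · intro l m hlm hm heq
    rw [e l (hlm.trans hm), e m hm] at heq
    have : τ.2 ⟨l, hlm.trans hm⟩ = τ.2 ⟨m, hm⟩ := Fin.ext (by omega)
    have := congrArg Fin.val (τ.2.injective this)
    dsimp only at this
    omega
  · intro q l hl
    simp [hl]
  · intro q l m hlm hm
    simp only [hlm.trans hm, hm, dite_true]
    exact hi q hlm
  · intro q l m hl hm hlm
    rw [e l hl, e m hm] at hlm
    simp only [hl, hm, dite_true]
    rw [nth_permWord, nth_permWord]
    have := Fin.lt_def.1 (ho q ⟨l, hl⟩ ⟨m, hm⟩ (Fin.lt_def.2 (by omega)))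
    omega

/-- The word of a longest common separable pattern, computed by `r` rounds. -/
def solution {K : ℕ} (r : ℕ) (σ : Fin K → FinPerm) : List ℕ :=
  longest (round^[r] (startTable (List.ofFn fun q => permWord (σ q))))

theorem solution_spec {K : ℕ} (hK : 1 ≤ K) (σ : Fin K → FinPerm) (r : ℕ)
    (hr : ∀ q, (σ q).length ≤ r) :
    ∃ h : SepWord (solution r σ), IsLongestCommonSeparablePattern σ h.toPerm := by
  have hN : ∀ q, (permWord (σ q)).length ≤ r := fun q => by simpa using hr q
  have hP : ∀ q l, l < (permWord (σ q)).length → nth (permWord (σ q)) l ≤ r :=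
    fun q l hl => (nth_permWord_le _ _ hl).trans (hr q)
  have hgood := goodTable_iterate hN hP r
  obtain ⟨h₁, h₂⟩ := longest_spec (round^[r] (startTable (List.ofFn fun q => permWord (σ q))))
  change solution r σ = [] ∨ _ at h₁
  have hs : ∃ h : SepWord (solution r σ), IsCommonSeparablePattern σ h.toPerm := by
    rcases h₁ with h₁ | ⟨e, he, h₁⟩
    -- The start value of the fold gives the empty permutation, a pattern of every permutation.
    · have h : SepWord (solution r σ) := by
        rw [h₁]
        exact ⟨by simp, by simp, fun a b c d _ _ _ _ hd => by simp at hd⟩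
      refine ⟨h, h.isSeparable_toPerm, fun q => Occurs.isPattern h (i := fun _ => 0)
        (a := 0) (b := 0) (c := 0) (d := 0) ?_⟩
      rw [h₁]
      exact ⟨le_rfl, le_rfl, by simp, by simp, by simp, by simp⟩
    · obtain ⟨a, b, c, d, -, -, hw, hi⟩ := hgood.sound e he
      change solution r σ = _ at h₁
      rw [← h₁] at hw hi
      exact ⟨hw, hw.isSeparable_toPerm, fun q => (hi q).elim fun i hi => hi.isPattern hw⟩
  obtain ⟨h, hc⟩ := hs
  refine ⟨h, hc, fun τ hτ => ?_⟩
  rcases Nat.eq_zero_or_pos τ.length with h0 | h0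
  · omega
  obtain ⟨i, hi⟩ := exists_commonOcc hτ
  -- Here `1 ≤ K` enters: without any permutation to contain them, common separable patterns would
  -- have unbounded length.
  have hlen : τ.length ≤ r := by
    obtain ⟨j, hj, -⟩ := hτ.2 ⟨0, hK⟩
    have := Fintype.card_le_of_injective j hj.injective
    simp only [Fintype.card_fin] at this
    exact this.trans (hr _)
  obtain ⟨l₀, h₃, h₄, h₅⟩ := exists_argmin (fun l => (nth (permWord τ) l : ℤ)) h0
  obtain ⟨l₁, h₆, h₇, h₈⟩ := exists_argmax (fun l => (nth (permWord τ) l : ℤ)) h0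
  obtain ⟨e, he, -, hl⟩ := hi.exists_mem hN hP r 0 τ.length l₀ l₁ h0 le_rfl (by omega)
    h₃ h₄ h₆ h₇ h₅ h₈
  have := h₂ e he
  change τ.length ≤ (longest _).length
  omega

/-! ### The table in polynomial time -/

section table
variable {α : Type} [Enc α]

theorem PT.allLt {l r : α → List ℕ} (hl : PT l) (hr : PT r) : PT (fun a => allLt (l a) (r a)) :=
  (hl.zip hr).all (p := fun _ (x : ℕ × ℕ) => decide (x.1 < x.2))
    (PT.lt (fst.comp snd) (snd.comp snd))

theorem PT.allEq {l r : α → List ℕ} (hl : PT l) (hr : PT r) : PT (fun a => allEq (l a) (r a)) :=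
  (hl.zip hr).all (p := fun _ (x : ℕ × ℕ) => !decide (x.1 < x.2) && !decide (x.2 < x.1))
    ((PT.lt (fst.comp snd) (snd.comp snd)).not.and (PT.lt (snd.comp snd) (fst.comp snd)).not)

theorem PT.sig {e : α → Entry} (he : PT e) : PT (fun a => sig (e a)) :=
  (snd.comp he).length.cons ((fst.comp (fst.comp (fst.comp he))).append
    ((snd.comp (fst.comp (fst.comp he))).append ((fst.comp (snd.comp (fst.comp he))).append
    (snd.comp (snd.comp (fst.comp he))))))

theorem PT.insertEntry {T : α → List Entry} {e : α → Entry} (hT : PT T) (he : PT e) :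
    PT (fun a => insertEntry (T a) (e a)) :=
  (hT.any (p := fun a e' => LCSep.allEq (LCSep.sig (e a)) (LCSep.sig e'))
    ((he.comp fst).sig.allEq snd.sig)).ite hT (he.cons hT)

theorem esize_insertEntry_le (T : List Entry) (e : Entry) :
    esize (insertEntry T e) ≤ esize T + esize e + 1 := by
  unfold insertEntry
  split
  · omega
  · rw [esize_cons]; omega

theorem esize_foldl_insertEntry_le (C : List Entry) :
    ∀ T : List Entry, esize (C.foldl insertEntry T) ≤ esize T + esize C := by
  induction C with
  | nil => intro T; simp
  | cons e C ih =>
    intro T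
    have h₁ := ih (insertEntry T e)
    have h₂ := esize_insertEntry_le T e
    rw [List.foldl_cons, esize_cons]
    omega

theorem PT.foldl_insertEntry {T C : α → List Entry} (hT : PT T) (hC : PT C) :
    PT (fun a => (C a).foldl LCSep.insertEntry (T a)) :=
  foldl (step := fun _ => LCSep.insertEntry) hC hT
    (PT.insertEntry (fst.comp fst) (snd.comp fst)) (hT.bdd.add hC.bdd) fun a l' hl' =>
      (esize_foldl_insertEntry_le l' (T a)).trans
        (Nat.add_le_add_left (esize_prefix_le hl') _)

theorem PT.shift {n : α → ℕ} {w : α → List ℕ} (hn : PT n) (hw : PT w) :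
    PT (fun a => shift (n a) (w a)) :=
  hw.map (f := fun a x => x + n a) (snd.add (hn.comp fst))

theorem PT.sums {e e' : α → Entry} (he : PT e) (he' : PT e') : PT (fun a => sums (e a) (e' a)) := by
  have h₁ : ∀ {e : α → Entry}, PT e → PT (fun a => (e a).1.1.1) :=
    fun he => fst.comp (fst.comp (fst.comp he))
  have h₂ : ∀ {e : α → Entry}, PT e → PT (fun a => (e a).1.1.2) :=
    fun he => snd.comp (fst.comp (fst.comp he))
  have h₃ : ∀ {e : α → Entry}, PT e → PT (fun a => (e a).1.2.1) :=
    fun he => fst.comp (snd.comp (fst.comp he))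
  have h₄ : ∀ {e : α → Entry}, PT e → PT (fun a => (e a).1.2.2) :=
    fun he => snd.comp (snd.comp (fst.comp he))
  have h₅ : ∀ {e : α → Entry}, PT e → PT (fun a => (e a).2) := fun he => snd.comp he
  refine ((h₂ he).allLt (h₁ he')).ite (PT.append
    (((h₄ he).allLt (h₃ he')).ite (PT.cons ?_ (const [])) (const []))
    (((h₄ he').allLt (h₃ he)).ite (PT.cons ?_ (const [])) (const []))) (const [])
  · exact (((h₁ he).pair (h₂ he')).pair ((h₃ he).pair (h₄ he'))).pair
      ((PT.shift (const 0) (h₅ he)).append (PT.shift (h₅ he).length (h₅ he')))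
  · exact (((h₁ he).pair (h₂ he')).pair ((h₃ he').pair (h₄ he))).pair
      ((PT.shift (h₅ he').length (h₅ he)).append (PT.shift (const 0) (h₅ he')))

theorem PT.round {T : α → List Entry} (hT : PT T) : PT (fun a => round (T a)) :=
  hT.foldl_insertEntry (hT.flatMap (f := fun a e => (T a).flatMap fun e' => LCSep.sums e e')
    ((hT.comp fst).flatMap (f := fun x e' => LCSep.sums x.2 e') ((snd.comp fst).sums snd)))

theorem PT.longest {T : α → List Entry} (hT : PT T) : PT (fun a => longest (T a)) :=
  foldl (step := fun _ (w : List ℕ) (e : Entry) => if decide (w.length < e.2.length) then e.2 else w)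
    hT (const [])
    ((PT.lt (fst.comp fst).length (snd.comp (snd.comp fst)).length).ite (snd.comp (snd.comp fst))
      (fst.comp fst)) hT.bdd fun a l' hl' => by
      change esize (LCSep.longest l') ≤ _
      rcases (longest_spec l').1 with h | ⟨e, he, h⟩
      · rw [h]; exact esize_pos _
      · have h₁ := esize_le_of_mem (hl'.subset he)
        have h₂ := esize_pair e
        rw [h]; omega

theorem PT.range {n : α → ℕ} (hn : PT n) : PT (fun a => List.range (n a)) := by
  have e : ∀ l : List Unit, l.foldl (fun s _ => s ++ [s.length]) [] = List.range l.length := by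
    intro l
    induction l using List.reverseRecOn with
    | nil => rfl
    | append_singleton l x ih => simp [ih, List.range_succ]
  have h := foldl (step := fun _ s _ => s ++ [s.length]) hn.replicate_unit (const [])
    ((fst.comp fst).append ((fst.comp fst).length.cons (const [])))
    (B := fun a => esize (n a) * (esize (n a) + 1) + 1)
    ((hn.bdd.mul (hn.bdd.add (.const 1))).add (.const 1)) fun a l' hl' => by
      have hlen := hl'.length_le
      rw [List.length_replicate] at hlen
      rw [e]
      refine (esize_list_le (B := esize (n a)) fun x hx => ?_).trans ?_
      · have := List.mem_range.1 hx
        simp only [esize_nat]; omega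
      · rw [List.length_range]
        gcongr
        simp only [esize_nat]; omega
  simpa only [e, List.length_replicate] using h

end table

/-! ### Size bounds -/

theorem esize_nats_le {l : List ℕ} {N : ℕ} (h : ∀ x ∈ l, x ≤ N) :
    esize l ≤ l.length * (2 * N + 2) + 1 :=
  esize_list_le (B := 2 * N + 1) fun x hx => by
    have := h x hx
    simp only [esize_nat]; omega

theorem points_bound {N : ℕ} : ∀ {ps : List (List ℕ)},
    (∀ p ∈ ps, p.length ≤ N ∧ ∀ x ∈ p, x ≤ N) →
    (points ps).length ≤ (N + 1) ^ ps.length ∧ ∀ x ∈ points ps,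
      (x.1.length = ps.length ∧ x.2.length = ps.length) ∧ (∀ y ∈ x.1, y ≤ N) ∧ ∀ y ∈ x.2, y ≤ N
  | [], _ => by simp [points]
  | p :: ps, h => by
    obtain ⟨h₁, h₂⟩ := points_bound (ps := ps) fun p hp => h p (List.mem_cons_of_mem _ hp)
    obtain ⟨h₃, h₄⟩ := h p List.mem_cons_self
    have e : points (p :: ps) = ((List.range p.length).zip p).flatMap fun x =>
        (points ps).map fun y => (x.1 :: y.1, x.2 :: y.2) := rfl
    rw [e]
    constructor
    · simp only [List.length_flatMap, List.length_map, List.map_const', List.sum_replicate,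
        List.length_zip, List.length_range, min_self, List.length_cons, smul_eq_mul, pow_succ']
      exact Nat.mul_le_mul (by omega) h₁
    · intro x hx
      simp only [List.mem_flatMap, List.mem_map] at hx
      obtain ⟨⟨i, v⟩, hi, y, hy, rfl⟩ := hx
      obtain ⟨h₅, h₆⟩ := List.of_mem_zip hi
      obtain ⟨⟨h₇, h₈⟩, h₉, h₁₀⟩ := h₂ y hy
      have := List.mem_range.1 h₅
      refine ⟨by simp [h₇, h₈], ?_, ?_⟩
      · intro z hz
        rcases List.mem_cons.1 hz with rfl | hz
        · omega
        · exact h₉ z hz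
      · intro z hz
        rcases List.mem_cons.1 hz with rfl | hz
        · exact h₄ _ h₆
        · exact h₁₀ z hz

theorem esize_points_le {N K : ℕ} {ps : List (List ℕ)}
    (h : ∀ p ∈ ps, p.length ≤ N ∧ ∀ x ∈ p, x ≤ N) (hK : ps.length ≤ K) :
    esize (points ps) ≤ (N + 1) ^ K * (2 * (K * (2 * N + 2) + 1) + 2) + 1 := by
  obtain ⟨h₁, h₂⟩ := points_bound h
  refine (esize_list_le (B := 2 * (K * (2 * N + 2) + 1) + 1) fun x hx => ?_).trans ?_
  · obtain ⟨⟨h₃, h₄⟩, h₅, h₆⟩ := h₂ x hx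
    have h₇ := esize_nats_le h₅
    have h₈ := esize_nats_le h₆
    have h₉ : ps.length * (2 * N + 2) ≤ K * (2 * N + 2) := Nat.mul_le_mul_right _ hK
    rw [h₃] at h₇
    rw [h₄] at h₈
    rw [esize_pair]
    omega
  · gcongr
    exact h₁.trans (Nat.pow_le_pow_right (by omega) hK)

/-- The lists come from functions `Fin m → Fin (N + 1)`. Applied to signatures with `m = 4 * K + 1`,
this bounds the number of entries by a power whose exponent is fixed together with `K`. -/
theorem length_le_of_nodup {m N : ℕ} {L : List (List ℕ)} (hL : L.Nodup)
    (h : ∀ l ∈ L, l.length = m ∧ ∀ x ∈ l, x ≤ N) : L.length ≤ (N + 1) ^ m := by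
  classical
  have hsub : L.toFinset ⊆ (Finset.univ : Finset (Fin m → Fin (N + 1))).image
      fun f => List.ofFn fun j => (f j : ℕ) := by
    intro l hl
    obtain ⟨rfl, hx⟩ := h l (by simpa using hl)
    refine Finset.mem_image.2 ⟨fun j => ⟨l[j], Nat.lt_succ_of_le (hx _ (List.getElem_mem _))⟩,
      Finset.mem_univ _, ?_⟩
    simp
  have := (Finset.card_le_card hsub).trans Finset.card_image_le
  rw [List.toFinset_card_of_nodup hL] at this
  simpa using this

theorem Sound.bounds {K : ℕ} (hK : 1 ≤ K) {P : Fin K → List ℕ} {N : ℕ} {e : Entry}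
    (hN : ∀ q, (P q).length ≤ N) (h : Sound P N e) :
    (∀ x ∈ sig e, x ≤ N) ∧ esize e ≤ 4 * (K * (2 * N + 2) + 1) + (N * (2 * N + 2) + 1) + 4 := by
  obtain ⟨a, b, c, d, hk, hb, hw, hi⟩ := h
  -- The word is bounded only through its occurrence in some `P q`, which exists because `1 ≤ K`.
  have hlen : e.2.length ≤ N := (hi ⟨0, hK⟩).elim fun i hi => hi.length_le.trans (hN _)
  have hle : ∀ q, a q ≤ N ∧ b q ≤ N ∧ c q ≤ N ∧ d q ≤ N := fun q => by
    obtain ⟨i, hi⟩ := hi q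
    have := hi.le_pos
    have := hi.le_val
    have := hb q
    omega
  have hmem : ∀ (f : Fin K → ℕ), (∀ q, f q ≤ N) → ∀ x ∈ List.ofFn f, x ≤ N := by
    intro f hf x hx
    obtain ⟨q, rfl⟩ := (List.mem_ofFn' _ _).1 hx
    exact hf q
  have ha := hmem a fun q => (hle q).1
  have hb := hmem b fun q => (hle q).2.1
  have hc := hmem c fun q => (hle q).2.2.1
  have hd := hmem d fun q => (hle q).2.2.2
  rw [HasKey] at hk
  constructor
  · intro x hx
    simp only [sig, hk, List.mem_cons, List.mem_append] at hx
    rcases hx with rfl | hx | hx | hx | hx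
    exacts [hlen, ha x hx, hb x hx, hc x hx, hd x hx]
  · have h₁ := esize_nats_le ha
    have h₂ := esize_nats_le hb
    have h₃ := esize_nats_le hc
    have h₄ := esize_nats_le hd
    have h₅ : esize e.2 ≤ e.2.length * (2 * N + 2) + 1 := esize_nats_le fun x hx => by
      obtain ⟨l, hl, rfl⟩ := List.getElem_of_mem hx
      have := hw.lt l hl
      simp [nth, hl] at this
      omega
    have h₆ : e.2.length * (2 * N + 2) ≤ N * (2 * N + 2) := Nat.mul_le_mul_right _ hlen
    simp only [List.length_ofFn] at *
    simp only [esize_pair, hk]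
    omega

theorem GoodTable.esize_le {K : ℕ} (hK : 1 ≤ K) {P : Fin K → List ℕ} {N : ℕ} {T : List Entry}
    (hN : ∀ q, (P q).length ≤ N) (h : GoodTable P N T) : esize T ≤ (N + 1) ^ (4 * K + 1) *
      (4 * (K * (2 * N + 2) + 1) + (N * (2 * N + 2) + 1) + 4 + 1) + 1 := by
  refine (esize_list_le fun e he => ((h.sound e he).bounds hK hN).2).trans ?_
  gcongr
  have := length_le_of_nodup (N := N) h.nodup fun l hl => by
    obtain ⟨e, he, rfl⟩ := List.mem_map.1 hl
    exact ⟨(h.sound e he).length_sig, ((h.sound e he).bounds hK hN).1⟩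
  simpa using this

/-! ### Binary numbers -/

/-- The successor of a binary number, least significant bit first. -/
def binSucc : List Bool → List Bool
  | [] => [true]
  | false :: l => true :: l
  | true :: l => false :: binSucc l

/-- This makes the binary word of a unary number computable by iterating `binSucc`. -/
theorem encodeNat_succ (n : ℕ) : encodeNat (n + 1) = binSucc (encodeNat n) := by
  have hpos : ∀ p : PosNum, encodePosNum p.succ = binSucc (encodePosNum p) := by
    intro p
    induction p with
    | one => rfl
    | bit0 p ih => rfl
    | bit1 p ih =>
      change false :: encodePosNum p.succ = false :: binSucc (encodePosNum p)
      rw [ih]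
  unfold encodeNat
  rw [Nat.cast_succ, Num.add_one]
  cases (n : Num) with
  | zero => rfl
  | pos p => exact hpos p

theorem encodeNat_zero : encodeNat 0 = [] := rfl

/-- The value of a binary number. -/
def binVal (l : List Bool) : ℕ := l.foldr (fun b v => v + v + cond b 1 0) 0

theorem binVal_encodeNat (n : ℕ) : binVal (encodeNat n) = n := by
  have h : ∀ l, binVal (binSucc l) = binVal l + 1 := by
    intro l
    induction l with
    | nil => rfl
    | cons b l ih =>
      cases b
      · simp [binVal, binSucc]
      · simp only [binVal, binSucc, List.foldr_cons, cond_true, cond_false] at *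
        omega
  induction n with
  | zero => rfl
  | succ n ih => rw [encodeNat_succ, h, ih]

theorem length_encodeNat_le (n : ℕ) : (encodeNat n).length ≤ n := by
  have h : ∀ l, (binSucc l).length ≤ l.length + 1 := by
    intro l
    induction l with
    | nil => simp [binSucc]
    | cons b l ih => cases b <;> simp [binSucc, ih]
  induction n with
  | zero => simp [encodeNat_zero]
  | succ n ih => rw [encodeNat_succ]; exact (h _).trans (by omega)

theorem esize_bools_le (l : List Bool) : esize l ≤ 4 * l.length + 1 := by
  have := esize_list_le (l := l) (B := 3) fun b _ => esize_bool_le b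
  omega

section binary
variable {α : Type} [Enc α]

theorem PT.binSucc {l : α → List Bool} (hl : PT l) : PT (fun a => binSucc (l a)) := by
  -- The state consists of the output so far, in reverse, and the carry. A carry left at the end
  -- becomes a new most significant bit.
  let step : List Bool × Bool → Bool → List Bool × Bool := fun s b =>
    if s.2 then (if b then (false :: s.1, true) else (true :: s.1, false)) else (b :: s.1, false)
  have e : ∀ (l : List Bool) (s : List Bool × Bool),
      (if (l.foldl step s).2 then true :: (l.foldl step s).1 else (l.foldl step s).1).reverse =
        s.1.reverse ++ if s.2 then LCSep.binSucc l else l := by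
    intro l
    induction l with
    | nil => rintro ⟨s, _ | _⟩ <;> simp [LCSep.binSucc]
    | cons b l ih =>
      rintro ⟨s, c⟩
      rw [List.foldl_cons, ih]
      cases c <;> cases b <;> simp [step, LCSep.binSucc]
  have hlen : ∀ (l : List Bool) (s : List Bool × Bool),
      (l.foldl step s).1.length = l.length + s.1.length := by
    intro l
    induction l with
    | nil => simp
    | cons b l ih =>
      rintro ⟨s, c⟩
      rw [List.foldl_cons, ih]
      cases c <;> cases b <;> simp [step] <;> omega
  have hs : PT fun x : ((List Bool × Bool) × Bool) × α => step x.1.1 x.1.2 :=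
    PT.ite (snd.comp (fst.comp fst))
      (PT.ite (snd.comp fst) (((const false).cons (fst.comp (fst.comp fst))).pair (const true))
        (((const true).cons (fst.comp (fst.comp fst))).pair (const false)))
      (((snd.comp fst).cons (fst.comp (fst.comp fst))).pair (const false))
  have h := foldl (step := fun _ => step) hl (const (([], true) : List Bool × Bool)) hs
    (B := fun a => 4 * esize (l a) + 5)
    (((PolyBdd.const 4).mul hl.bdd).add (.const 5)) fun a l' hl' => by
      have h₁ := esize_bools_le (l'.foldl step ([], true)).1
      have h₂ := esize_bool_le (l'.foldl step ([], true)).2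
      have h₃ := hl'.length_le.trans (length_le_esize _)
      rw [hlen] at h₁
      rw [esize_pair]
      simp only [List.length_nil] at h₁
      omega
  have := (PT.ite (snd.comp h) ((const true).cons (fst.comp h)) (fst.comp h)).reverse
  simpa only [e, List.reverse_nil, List.nil_append, if_true] using this

theorem PT.encodeNat {n : α → ℕ} (hn : PT n) : PT (fun a => encodeNat (n a)) := by
  have e : ∀ l : List Unit,
      l.foldl (fun s _ => LCSep.binSucc s) [] = Computability.encodeNat l.length := by
    intro l
    induction l using List.reverseRecOn with
    | nil => rfl
    | append_singleton l x ih => simp [ih, encodeNat_succ]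
  have h := foldl (step := fun _ s _ => LCSep.binSucc s) hn.replicate_unit (const [])
    (fst.comp fst).binSucc (B := fun a => 4 * esize (n a) + 1)
    (((PolyBdd.const 4).mul hn.bdd).add (.const 1)) fun a l' hl' => by
      have h₁ := hl'.length_le
      have h₂ := length_encodeNat_le l'.length
      have h₃ := esize_bools_le (Computability.encodeNat l'.length)
      rw [List.length_replicate] at h₁
      rw [e, esize_nat]
      omega
  simpa only [e, List.length_replicate] using h

theorem PT.encodeEntry {n : α → ℕ} (hn : PT n) : PT (fun a => encodeEntry (n a)) := by
  refine PT.append (hn.encodeNat.map (f := fun _ b => Γ'.bit b) ?_) (const [Γ'.comma])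
  have := PT.ite (snd : PT fun x : α × Bool => x.2) (const (Γ'.bit true)) (const (Γ'.bit false))
  convert! this using 2 with x
  cases x.2 <;> rfl

end binary

/-! ### Reading the input -/

/-- Append a bit to the first number. -/
def pushBit (k : ℕ) : List (List ℕ) → List (List ℕ)
  -- Since the input is read from its end, the most significant bit of a number comes first.
  | (v :: p) :: S => ((v + v + k) :: p) :: S
  | S => S

/-- Begin a number in the first list. -/
def pushNum : List (List ℕ) → List (List ℕ)
  | p :: S => (0 :: p) :: S
  | [] => []

/-- Process one symbol of the input, which is read from its end. -/
def parseStep (S : List (List ℕ)) (c : Γ') : List (List ℕ) :=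
  -- Symbols are tested through their numbers, which are also their trees. The last case serves the
  -- closing bracket, which is met before the numbers of its word.
  if decide (symbols.idxOf c < 1) then pushBit 0 S
  else if decide (symbols.idxOf c < 2) then pushBit 1 S
  else if decide (symbols.idxOf c < 3) then pushNum S
  else [] :: S

theorem foldr_parseStep_bits (l : List Bool) (p : List ℕ) (S : List (List ℕ)) :
    (l.map Γ'.bit).foldr (fun c S => parseStep S c) ((0 :: p) :: S) = (binVal l :: p) :: S := by
  induction l with
  | nil => rfl
  | cons b l ih =>
    rw [List.map_cons, List.foldr_cons, ih]
    cases b <;> rfl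

theorem foldr_parseStep_encodeEntry (v : ℕ) (p : List ℕ) (S : List (List ℕ)) :
    (encodeEntry v).foldr (fun c S => parseStep S c) (p :: S) = (v :: p) :: S := by
  rw [encodeEntry, List.foldr_append]
  exact (foldr_parseStep_bits _ p S).trans (by rw [binVal_encodeNat])

theorem foldr_parseStep_encodePerm (σ : FinPerm) (S : List (List ℕ)) :
    (encodePerm σ).foldr (fun c S => parseStep S c) S = permWord σ :: S := by
  have h : ∀ l : List ℕ, (l.flatMap encodeEntry).foldr (fun c S => parseStep S c) ([] :: S) =
      l :: S := by
    intro l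
    induction l with
    | nil => rfl
    | cons v l ih =>
      rw [List.flatMap_cons, List.foldr_append, ih, foldr_parseStep_encodeEntry]
  rw [encodePerm, List.foldr_append]
  exact h (permWord σ)

theorem foldl_parseStep_encodeTuple {K : ℕ} (σ : Fin K → FinPerm) :
    (encodeTuple σ).reverse.foldl parseStep [] = List.ofFn fun q => permWord (σ q) := by
  have h : ∀ l : List FinPerm,
      (l.flatMap encodePerm).foldr (fun c S => parseStep S c) [] = l.map permWord := by
    intro l
    induction l with
    | nil => rfl
    | cons τ l ih =>
      rw [List.flatMap_cons, List.foldr_append, ih, foldr_parseStep_encodePerm]; rfl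
  rw [List.foldl_reverse, encodeTuple, h, List.map_ofFn]
  rfl

/-- Sizes never decrease during parsing, so all intermediate states are bounded by the final one,
the list of the given words. -/
theorem esize_le_parseStep (S : List (List ℕ)) (c : Γ') : esize S ≤ esize (parseStep S c) := by
  have h : ∀ k, esize S ≤ esize (pushBit k S) := by
    intro k
    rcases S with _ | ⟨_ | ⟨v, p⟩, S⟩
    · exact le_rfl
    · exact le_rfl
    · simp [pushBit]; omega
  unfold parseStep
  split_ifs
  · exact h 0
  · exact h 1
  · rcases S with _ | ⟨p, S⟩
    · exact le_rfl
    · simp [pushNum]; omega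
  · simp; omega

theorem esize_foldl_parseStep_mono {l l' : List Γ'} (h : l' <+: l) (S : List (List ℕ)) :
    esize (l'.foldl parseStep S) ≤ esize (l.foldl parseStep S) := by
  obtain ⟨t, rfl⟩ := h
  rw [List.foldl_append]
  generalize l'.foldl parseStep S = S'
  induction t generalizing S' with
  | nil => exact le_rfl
  | cons c t ih => exact (esize_le_parseStep S' c).trans (ih _)

theorem length_le_encodeTuple {K : ℕ} (σ : Fin K → FinPerm) (q : Fin K) :
    (σ q).length ≤ (encodeTuple σ).length := by
  have h : ∀ l : List ℕ, l.length ≤ (l.flatMap encodeEntry).length := by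
    intro l
    induction l with
    | nil => simp
    | cons v l ih =>
      simp only [List.flatMap_cons, List.length_append, List.length_cons]
      have : 1 ≤ (encodeEntry v).length := by simp [encodeEntry]
      omega
  have h₁ : (σ q).length ≤ (encodePerm (σ q)).length := by
    have := h (permWord (σ q))
    rw [length_permWord] at this
    simp only [encodePerm, List.length_append]
    exact this.trans (Nat.le_add_right _ _)
  refine h₁.trans ?_
  rw [encodeTuple, List.length_flatMap]
  exact List.single_le_sum (by simp) _ (List.mem_map_of_mem (by simp))

/-! ### The complete algorithm on encoded tuples. -/

/-- Tuples of permutations are given by their reversed words. -/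
instance {K : ℕ} : Enc (Fin K → FinPerm) := ⟨fun σ => enc (encodeTuple σ).reverse⟩

section main
variable {K : ℕ}

theorem PT.word : PT fun σ : Fin K → FinPerm => (encodeTuple σ).reverse :=
  of_enc_eq fun _ => rfl

theorem polyBdd_length : PolyBdd fun σ : Fin K → FinPerm => (encodeTuple σ).length :=
  PT.word.bdd.mono fun σ => by
    have := length_le_esize (encodeTuple σ).reverse
    rwa [List.length_reverse] at this

theorem words_bounds (σ : Fin K → FinPerm) :
    ∀ p ∈ List.ofFn fun q => permWord (σ q), p.length ≤ (encodeTuple σ).length ∧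
      ∀ x ∈ p, x ≤ (encodeTuple σ).length := by
  intro p hp
  obtain ⟨q, rfl⟩ := (List.mem_ofFn' _ _).1 hp
  have := length_le_encodeTuple σ q
  exact ⟨by simpa using this, fun x hx => (le_of_mem_permWord hx).trans this⟩

theorem PT.pushBit {α : Type} [Enc α] (k : ℕ) {S : α → List (List ℕ)} (hS : PT S) :
    PT (fun a => pushBit k (S a)) := by
  refine hS.list_cases (f := fun _ => []) (g := fun _ t p => LCSep.pushBit k (p :: t)) (const _) ?_
    (fun a h => by simp [h, LCSep.pushBit]) (fun a p t h => by rw [h])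
  refine list_cases (l := fun x : α × List (List ℕ) × List ℕ => x.2.2)
    (f := fun x => x.2.2 :: x.2.1) (g := fun x p v => ((v + v + k) :: p) :: x.2.1) (snd.comp snd)
    ((snd.comp snd).cons (fst.comp snd)) ?_ (fun x h => by rw [h]; rfl)
    (fun x v p h => by rw [h]; rfl)
  exact ((((snd.comp snd).add (snd.comp snd)).add (const k)).cons (fst.comp snd)).cons
    (fst.comp (snd.comp fst))

theorem PT.pushNum {α : Type} [Enc α] {S : α → List (List ℕ)} (hS : PT S) :
    PT (fun a => pushNum (S a)) :=
  hS.list_cases (f := fun _ => []) (g := fun _ t p => (0 :: p) :: t) (const _)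
    (((const 0).cons (snd.comp snd)).cons (fst.comp snd)) (fun a h => by rw [h]; rfl)
    (fun a p t h => by rw [h]; rfl)

theorem PT.parseStep {α : Type} [Enc α] {S : α → List (List ℕ)} {c : α → Γ'} (hS : PT S)
    (hc : PT c) : PT (fun a => parseStep (S a) (c a)) := by
  have hi : PT fun a => symbols.idxOf (c a) :=
    (of_enc_eq (f := fun c : Γ' => symbols.idxOf c) fun _ => rfl).comp hc
  exact (hi.lt (const 1)).ite (hS.pushBit 0) ((hi.lt (const 2)).ite (hS.pushBit 1)
    ((hi.lt (const 3)).ite hS.pushNum ((const []).cons hS)))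

/-- Passing from binary to unary is affordable: the values are at most the length of their
permutation, hence at most the length of the input. -/
theorem PT.words : PT fun σ : Fin K → FinPerm => List.ofFn fun q => permWord (σ q) := by
  have h := foldl (α := Fin K → FinPerm) (step := fun _ => LCSep.parseStep) PT.word (const [])
    (PT.parseStep (fst.comp fst) (snd.comp fst))
    (B := fun σ => K * ((encodeTuple σ).length * (2 * (encodeTuple σ).length + 2) + 1 + 1) + 1)
    (((PolyBdd.const K).mul (((polyBdd_length.mul (((PolyBdd.const 2).mul polyBdd_length).add
      (.const 2))).add (.const 1)).add (.const 1))).add (.const 1)) fun σ l' hl' => by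
      refine (esize_foldl_parseStep_mono hl' []).trans ?_
      rw [foldl_parseStep_encodeTuple]
      refine (esize_list_le fun p hp => ?_).trans (by rw [List.length_ofFn])
      obtain ⟨h₁, h₂⟩ := words_bounds σ p hp
      refine (esize_nats_le h₂).trans ?_
      gcongr
  simpa only [foldl_parseStep_encodeTuple] using h

/-- The right fold `points` is run as a left fold over the reversed list. Each intermediate result
is `points` of at most `K` of the words, so one bound covers all of them. -/
theorem PT.points_words :
    PT fun σ : Fin K → FinPerm => points (List.ofFn fun q => permWord (σ q)) := by
  let step : List (List ℕ × List ℕ) → List ℕ → List (List ℕ × List ℕ) := fun acc p =>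
    ((List.range p.length).zip p).flatMap fun x => acc.map fun y => (x.1 :: y.1, x.2 :: y.2)
  have e : ∀ ps : List (List ℕ), ps.foldl step [([], [])] = points ps.reverse := by
    intro ps
    rw [points, List.foldr_reverse]
  have hs : PT fun x : (List (List ℕ × List ℕ) × List ℕ) × (Fin K → FinPerm) =>
      step x.1.1 x.1.2 := by
    refine (PT.zip (PT.range (snd.comp fst).length) (snd.comp fst)).flatMap
      (f := fun (a : (List (List ℕ × List ℕ) × List ℕ) × (Fin K → FinPerm)) x =>
        a.1.1.map fun y => (x.1 :: y.1, x.2 :: y.2)) ?_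
    refine PT.map (l := fun z : ((List (List ℕ × List ℕ) × List ℕ) × (Fin K → FinPerm)) × (ℕ × ℕ)
        => z.1.1.1)
      (f := fun z y => (z.2.1 :: y.1, z.2.2 :: y.2)) (fst.comp (fst.comp fst)) ?_
    exact ((fst.comp (snd.comp fst)).cons (fst.comp snd)).pair
      ((snd.comp (snd.comp fst)).cons (snd.comp snd))
  have h := foldl (step := fun _ => step) PT.words.reverse (const [([], [])]) hs
    (B := fun σ => ((encodeTuple σ).length + 1) ^ K *
      (2 * (K * (2 * (encodeTuple σ).length + 2) + 1) + 2) + 1)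
    ((((polyBdd_length.add (.const 1)).pow K).mul (((PolyBdd.const 2).mul (((PolyBdd.const K).mul
      (((PolyBdd.const 2).mul polyBdd_length).add (.const 2))).add (.const 1))).add
      (.const 2))).add (.const 1)) fun σ l' hl' => by
      rw [e]
      refine esize_points_le (fun p hp => words_bounds σ p ?_) ?_
      · exact List.mem_reverse.1 (hl'.subset (List.mem_reverse.1 hp))
      · simpa using hl'.length_le
  simpa only [e, List.reverse_reverse] using h

theorem PT.startTable_words :
    PT fun σ : Fin K → FinPerm => startTable (List.ofFn fun q => permWord (σ q)) :=
  PT.foldl_insertEntry (const []) (PT.points_words.map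
    (f := fun _ x => (((x.1, x.1), (x.2, x.2)), [0]))
    ((((fst.comp snd).pair (fst.comp snd)).pair ((snd.comp snd).pair (snd.comp snd))).pair
      (const [0])))

/-- One round is performed per input symbol, which is enough because no permutation is longer than
the input. All intermediate tables are good, and `GoodTable.esize_le` bounds them uniformly. -/
theorem PT.solution (hK : 1 ≤ K) :
    PT fun σ : Fin K → FinPerm => solution (encodeTuple σ).length σ := by
  have e : ∀ (l : List Γ') (T : List Entry),
      l.foldl (fun T _ => LCSep.round T) T = LCSep.round^[l.length] T := by
    intro l
    induction l with
    | nil => intro T; rfl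
    | cons c l ih => intro T; exact ih _
  have h := foldl (step := fun _ T _ => LCSep.round T) PT.word PT.startTable_words
    (fst.comp fst).round
    (B := fun σ : Fin K → FinPerm => ((encodeTuple σ).length + 1) ^ (4 * K + 1) *
      (4 * (K * (2 * (encodeTuple σ).length + 2) + 1) +
        ((encodeTuple σ).length * (2 * (encodeTuple σ).length + 2) + 1) + 4 + 1) + 1)
    (by
      have h2 : PolyBdd fun σ : Fin K → FinPerm => 2 * (encodeTuple σ).length + 2 :=
        ((PolyBdd.const 2).mul polyBdd_length).add (.const 2)
      exact (((polyBdd_length.add (.const 1)).pow _).mul ((((((PolyBdd.const 4).mul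
        (((PolyBdd.const K).mul h2).add (.const 1))).add ((polyBdd_length.mul h2).add
        (.const 1))).add (.const 4))).add (.const 1))).add (.const 1))
    fun σ l' _ => by
      rw [e]
      have hN : ∀ q, (permWord (σ q)).length ≤ (encodeTuple σ).length := fun q => by
        simpa using length_le_encodeTuple σ q
      exact (goodTable_iterate hN (fun q l hl => (nth_permWord_le _ _ hl).trans
        (length_le_encodeTuple σ q)) _).esize_le hK hN
  have h' := h.longest
  simpa only [e, List.length_reverse, LCSep.solution] using h'

theorem solvableInPolyTime (hK : 1 ≤ K) :
    SolvableInPolyTime (encodeTuple : (Fin K → FinPerm) → List Γ') encodePerm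
      IsLongestCommonSeparablePattern := by
  choose h hs using fun σ : Fin K → FinPerm =>
    solution_spec hK σ (encodeTuple σ).length (length_le_encodeTuple σ)
  refine ⟨fun σ => (h σ).toPerm, hs,
    PT.nonempty_tm2ComputableInPolyTime (fun _ => rfl) ?_⟩
  -- The permutation itself is never constructed by the machine: its output word is obtained
  -- directly from the letters of `solution`, raised by one.
  have e : ∀ σ, encodePerm (h σ).toPerm =
      ((solution (encodeTuple σ).length σ).map (· + 1)).flatMap encodeEntry ++ [Γ'.ket] := by
    intro σ
    rw [← (h σ).permWord_toPerm]
    rfl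
  simp only [e]
  exact ((((PT.solution hK).map (f := fun _ x => x + 1) (PT.succ .snd)).flatMap
    (f := fun _ x => encodeEntry x) (PT.encodeEntry .snd)).append (.const [Γ'.ket])).reverse

end main

end LCSep

theorem mainTheorem1 (K : ℕ) (hK : 1 ≤ K) :
    LCSep.SolvableInPolyTime
      (LCSep.encodeTuple : (Fin K → LCSep.FinPerm) → List Computability.Γ')
      LCSep.encodePerm LCSep.IsLongestCommonSeparablePattern :=
  LCSep.solvableInPolyTime hK
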